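/- Let $M\ge 0$ and let $\sigma_1=\begin{pmatrix}0&1\\1&0\end{pmatrix}$, $\sigma_3=\begin{pmatrix}1&0\\0&-1\end{pmatrix}$. On $L^2(\mathbb R;\mathbb C^2)$ let $H=-i\frac{d}{dx}\otimes\sigma_1+M\otimes\sigma_3$ be the free Dirac operator with domain $W^{1,2}(\mathbb R)\otimes\mathbb C^2$, and, for $\Lambda\in\mathbb C^{2\times2}$, let $H^\Lambda$ be the operator acting as $-i\frac{d}{dx}\otimes\sigma_1+M\otimes\sigma_3$ on $\mathbb R\setminus\{0\}$ with domain $$\{\psi\in W^{1,2}(\mathbb R\setminus\{0\})\otimes\mathbb C^2 \mid \psi(0+)=\Lambda\psi(0-)\}.$$ Let $h\in L^1(\mathbb R;\mathbb R)\cap L^\infty(\mathbb R;\mathbb R)$ with $\int_{\mathbb R}h(x)\,dx=1$, and for $\varepsilon>0$ put $h_\varepsilon(x)=\varepsilon^{-1}h(x/\varepsilon)$. Let $A$ be either of the form $A=i\varphi I$ with $\varphi\in\mathbb R$, $\varphi\ne0$ and $\varphi\neq(2k+1)\pi$ for all $k\in\mathbb Z$, or of the form $$A=\begin{pmatrix}a&ib\\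 ic&-a\end{pmatrix},\qquad a,b,c\in\mathbb R,\quad \det A\neq((2k+1)\pi)^2\ \text{ for all integers } k\ge 0.$$ Let $H^A_\varepsilon=H+ih_\varepsilon(x)\otimes\sigma_1A$ with domain $W^{1,2}(\mathbb R)\otimes\mathbb C^2$, and $\Lambda=\exp(A)$. Then the bounded resolvents $(H^A_\varepsilon+i)^{-1}$ (for every $\varepsilon>0$) and $(H^\Lambda+i)^{-1}$ exist on $L^2(\mathbb R;\mathbb C^2)$, and $$\lim_{\varepsilon\to0+}\big\|(H^A_\varepsilon+i)^{-1}-(H^\Lambda+i)^{-1}\big\|=0$$ in the operator norm, i.e. $H^A_\varepsilon$ converges to $H^\Lambda$ in the norm resolvent sense as $\varepsilon\to0+$. -/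

import Mathlib

open MeasureTheory Filter Topology
open scoped ENNReal ContDiff

noncomputable section

namespace DiracPoint

/-- The value space `ℂ²` with its Euclidean norm. -/
abbrev Spinor : Type := EuclideanSpace ℂ (Fin 2)

/-- The Hilbert space `L²(ℝ; ℂ²)`. -/
abbrev L2 : Type := Lp Spinor 2 (volume : Measure ℝ)

/-- The first Pauli matrix. -/
def sigma1 : Matrix (Fin 2) (Fin 2) ℂ := !![0, 1; 1, 0]

/-- The third Pauli matrix. -/
def sigma3 : Matrix (Fin 2) (Fin 2) ℂ := !![1, 0; 0, -1]

/-- `g` is the weak derivative of `ψ` on the open set `U`, tested against `C_c^∞(U)`. -/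
def HasWeakDerivOn (U : Set ℝ) (ψ g : ℝ → Spinor) : Prop :=
  ∀ φ : ℝ → ℝ, ContDiff ℝ ∞ φ → HasCompactSupport φ → tsupport φ ⊆ U →
    ∫ x, deriv φ x • ψ x = - ∫ x, φ x • g x

theorem integrable_test_smul {φ : ℝ → ℝ} (hφ : Continuous φ) (hc : HasCompactSupport φ)
    (f : L2) : Integrable (fun x => φ x • f x) :=
  ((Lp.memLp f).locallyIntegrable (by norm_num)).integrable_smul_left_of_hasCompactSupport hφ hc

theorem HasWeakDerivOn.add {U : Set ℝ} {ψ₁ ψ₂ g₁ g₂ : L2} (h₁ : HasWeakDerivOn U ψ₁ g₁)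
    (h₂ : HasWeakDerivOn U ψ₂ g₂) : HasWeakDerivOn U (ψ₁ + ψ₂ : L2) (g₁ + g₂ : L2) := by
  intro φ hφ hc hs
  have hd : Continuous (deriv φ) := hφ.continuous_deriv (by simp)
  have e₁ : ∫ x, deriv φ x • (ψ₁ + ψ₂ : L2) x
      = ∫ x, (deriv φ x • ψ₁ x + deriv φ x • ψ₂ x) := by
    refine integral_congr_ae ?_
    filter_upwards [Lp.coeFn_add ψ₁ ψ₂] with x hx
    simp only [hx, Pi.add_apply, smul_add]
  have e₂ : ∫ x, φ x • (g₁ + g₂ : L2) x = ∫ x, (φ x • g₁ x + φ x • g₂ x) := by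
    refine integral_congr_ae ?_
    filter_upwards [Lp.coeFn_add g₁ g₂] with x hx
    simp only [hx, Pi.add_apply, smul_add]
  rw [e₁, e₂, integral_add (integrable_test_smul hd hc.deriv _) (integrable_test_smul hd hc.deriv _),
    integral_add (integrable_test_smul hφ.continuous hc _)
      (integrable_test_smul hφ.continuous hc _), h₁ φ hφ hc hs, h₂ φ hφ hc hs]
  abel

theorem HasWeakDerivOn.smul {U : Set ℝ} {ψ g : L2} (c : ℂ) (h : HasWeakDerivOn U ψ g) :
    HasWeakDerivOn U (c • ψ : L2) (c • g : L2) := by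
  intro φ hφ hc hs
  have e₁ : ∫ x, deriv φ x • (c • ψ : L2) x = ∫ x, c • (deriv φ x • ψ x) := by
    refine integral_congr_ae ?_
    filter_upwards [Lp.coeFn_smul c ψ] with x hx
    rw [hx, Pi.smul_apply, smul_comm]
  have e₂ : ∫ x, φ x • (c • g : L2) x = ∫ x, c • (φ x • g x) := by
    refine integral_congr_ae ?_
    filter_upwards [Lp.coeFn_smul c g] with x hx
    rw [hx, Pi.smul_apply, smul_comm]
  rw [e₁, e₂, integral_smul, integral_smul, h φ hφ hc hs, smul_neg]

theorem HasWeakDerivOn.zero (U : Set ℝ) : HasWeakDerivOn U (0 : L2) (0 : L2) := by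
  simpa using HasWeakDerivOn.smul (U := U) (ψ := 0) (g := 0) 0 (by
    intro φ _ _ _
    have e₁ : ∫ x, deriv φ x • (0 : L2) x = ∫ _ : ℝ, (0 : Spinor) := by
      refine integral_congr_ae ?_
      filter_upwards [Lp.coeFn_zero Spinor 2 (volume : Measure ℝ)] with x hx
      rw [hx, Pi.zero_apply, smul_zero]
    have e₂ : ∫ x, φ x • (0 : L2) x = ∫ _ : ℝ, (0 : Spinor) := by
      refine integral_congr_ae ?_
      filter_upwards [Lp.coeFn_zero Spinor 2 (volume : Measure ℝ)] with x hx
      rw [hx, Pi.zero_apply, smul_zero]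
    rw [e₁, e₂]; simp)

theorem HasWeakDerivOn.mono {U V : Set ℝ} {ψ g : ℝ → Spinor} (h : HasWeakDerivOn V ψ g)
    (hUV : U ⊆ V) : HasWeakDerivOn U ψ g :=
  fun φ hφ hc hs => h φ hφ hc (hs.trans hUV)

/-- Weak derivatives on `ℝ ∖ {0}` are unique. -/
theorem HasWeakDerivOn.unique {ψ g₁ g₂ : L2} (h₁ : HasWeakDerivOn {0}ᶜ ψ g₁)
    (h₂ : HasWeakDerivOn {0}ᶜ ψ g₂) : g₁ = g₂ := by
  have hU : IsOpen ({0}ᶜ : Set ℝ) := isOpen_compl_singleton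
  have hl₁ : LocallyIntegrable g₁ := (Lp.memLp g₁).locallyIntegrable (by norm_num)
  have hl₂ : LocallyIntegrable g₂ := (Lp.memLp g₂).locallyIntegrable (by norm_num)
  have key := hU.ae_eq_zero_of_integral_contDiff_smul_eq_zero (μ := volume)
    (f := fun x => g₁ x - g₂ x) ((hl₁.sub hl₂).locallyIntegrableOn _) (by
      intro φ hφ hc hs
      simp only [smul_sub]
      rw [integral_sub (integrable_test_smul hφ.continuous hc _)
        (integrable_test_smul hφ.continuous hc _), sub_eq_zero]
      exact neg_injective ((h₁ φ hφ hc hs).symm.trans (h₂ φ hφ hc hs)))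
  have h0 : ∀ᵐ x : ℝ, x ∈ ({0}ᶜ : Set ℝ) := by simp [ae_iff]
  refine Lp.ext ?_
  filter_upwards [key, h0] with x hx hx0
  exact sub_eq_zero.1 (hx hx0)

/-- The Sobolev space `W^{1,2}(U; ℂ²)`, for `U = ℝ` or `U = ℝ ∖ {0}`, inside `L²(ℝ; ℂ²)`. -/
def sobolev (U : Set ℝ) : Submodule ℂ L2 where
  carrier := {ψ | ∃ g : L2, HasWeakDerivOn U ψ g}
  add_mem' := by
    rintro _ _ ⟨g₁, h₁⟩ ⟨g₂, h₂⟩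
    exact ⟨g₁ + g₂, h₁.add h₂⟩
  zero_mem' := ⟨0, HasWeakDerivOn.zero U⟩
  smul_mem' := by
    rintro c _ ⟨g, h⟩
    exact ⟨c • g, h.smul c⟩

/-- The weak derivative on `ℝ ∖ {0}`, as a linear map on `W^{1,2}(ℝ ∖ {0}; ℂ²)`. -/
def weakDeriv : sobolev {0}ᶜ →ₗ[ℂ] L2 where
  toFun ψ := ψ.2.choose
  map_add' ψ₁ ψ₂ :=
    HasWeakDerivOn.unique (ψ₁ + ψ₂).2.choose_spec (ψ₁.2.choose_spec.add ψ₂.2.choose_spec)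
  map_smul' c ψ :=
    HasWeakDerivOn.unique (c • ψ).2.choose_spec (ψ.2.choose_spec.smul c)

/-- A constant matrix acting pointwise on `L²(ℝ; ℂ²)`. -/
def matOp (B : Matrix (Fin 2) (Fin 2) ℂ) : L2 →L[ℂ] L2 :=
  (Matrix.toEuclideanCLM (𝕜 := ℂ) (n := Fin 2) B).compLpL 2 volume

/-- The matrix potential `w(x) ⊗ B` with `w` bounded, as a multiplication operator. -/
def potential (w : ℝ → ℝ) (hw : MemLp w ∞ volume) (B : Matrix (Fin 2) (Fin 2) ℂ) :
    L2 →L[ℂ] L2 :=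
  (ContinuousLinearMap.lsmul ℂ ℂ : ℂ →L[ℂ] Spinor →L[ℂ] Spinor).holderL volume ∞ 2 2
    (MemLp.toLp (fun x => (w x : ℂ)) hw.ofReal) ∘L matOp B

/-- The operator acting as `-i d/dx ⊗ σ₁ + M ⊗ σ₃` on the maximal domain
`W^{1,2}(ℝ ∖ {0}) ⊗ ℂ²`. -/
def maxDirac (M : ℝ) : L2 →ₗ.[ℂ] L2 where
  domain := sobolev {0}ᶜ
  toFun := (-Complex.I) • ((matOp sigma1 : L2 →ₗ[ℂ] L2) ∘ₗ weakDeriv)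
    + (M : ℂ) • ((matOp sigma3 : L2 →ₗ[ℂ] L2) ∘ₗ (sobolev {0}ᶜ).subtype)

/-- The free Dirac operator `H`, with domain `W^{1,2}(ℝ) ⊗ ℂ²`. -/
def freeDirac (M : ℝ) : L2 →ₗ.[ℂ] L2 :=
  (maxDirac M).domRestrict (sobolev Set.univ)

theorem freeDirac_domain (M : ℝ) : (freeDirac M).domain = sobolev Set.univ :=
  inf_eq_left.2 fun _ ⟨g, h⟩ => ⟨g, h.mono (Set.subset_univ _)⟩

/-- The scaled function `h_ε(x) = ε⁻¹ h(x / ε)`. -/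
def scaled (h : ℝ → ℝ) (ε : ℝ) : ℝ → ℝ := fun x => 1 / ε * h (x / ε)

theorem memLp_scaled {h : ℝ → ℝ} (hh : MemLp h ∞ volume) (ε : ℝ) :
    MemLp (scaled h ε) ∞ volume := by
  unfold scaled
  rcases eq_or_ne ε 0 with rfl | hε
  · simp
  · refine MemLp.const_mul ?_ _
    have hi : ε⁻¹ ≠ 0 := inv_ne_zero hε
    have h2 : MemLp h ∞ (Measure.map (fun x => ε⁻¹ * x) volume) := by
      rw [Real.map_volume_mul_left hi]
      exact hh.smul_measure ENNReal.ofReal_ne_top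
    have h3 := h2.comp_of_map (by fun_prop)
    simpa [Function.comp_def, div_eq_inv_mul] using h3

/-- The approximating operator `H_ε^A = H + i h_ε(x) ⊗ σ₁ A`, with domain `W^{1,2}(ℝ) ⊗ ℂ²`. -/
def approxDirac (M : ℝ) (h : ℝ → ℝ) (hh : MemLp h ∞ volume) (A : Matrix (Fin 2) (Fin 2) ℂ)
    (ε : ℝ) : L2 →ₗ.[ℂ] L2 :=
  (potential (scaled h ε) (memLp_scaled hh ε) (Complex.I • (sigma1 * A)) : L2 →ₗ[ℂ] L2)
    +ᵥ freeDirac M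

/-- `ψ(0-) = m` and `ψ(0+) = p`, for the representative of `ψ` continuous on `ℝ ∖ {0}`. -/
def HasTraces (ψ : L2) (m p : Spinor) : Prop :=
  ∃ f : ℝ → Spinor, f =ᵐ[volume] ψ ∧ ContinuousOn f {0}ᶜ ∧
    Tendsto f (𝓝[<] 0) (𝓝 m) ∧ Tendsto f (𝓝[>] 0) (𝓝 p)

/-- The domain `{ψ ∈ W^{1,2}(ℝ ∖ {0}) ⊗ ℂ² | ψ(0+) = Λ ψ(0-)}`. -/
def pointDomain (Λ : Matrix (Fin 2) (Fin 2) ℂ) : Submodule ℂ L2 where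
  carrier := {ψ | ψ ∈ sobolev {0}ᶜ ∧
    ∃ m : Spinor, HasTraces ψ m (Matrix.toEuclideanCLM (𝕜 := ℂ) (n := Fin 2) Λ m)}
  add_mem' := by
    rintro ψ₁ ψ₂ ⟨hs₁, m₁, f₁, he₁, hc₁, hl₁, hr₁⟩ ⟨hs₂, m₂, f₂, he₂, hc₂, hl₂, hr₂⟩
    refine ⟨add_mem hs₁ hs₂, m₁ + m₂, f₁ + f₂, ?_, hc₁.add hc₂, hl₁.add hl₂, ?_⟩
    · exact (he₁.add he₂).trans (Lp.coeFn_add ψ₁ ψ₂).symm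
    · rw [map_add]
      exact hr₁.add hr₂
  zero_mem' := by
    refine ⟨zero_mem _, 0, 0, (Lp.coeFn_zero _ _ _).symm, continuousOn_const,
      tendsto_const_nhds, ?_⟩
    rw [map_zero]
    exact tendsto_const_nhds
  smul_mem' := by
    rintro c ψ ⟨hs, m, f, he, hc, hl, hr⟩
    refine ⟨Submodule.smul_mem _ c hs, c • m, c • f, ?_, hc.const_smul c, hl.const_smul c, ?_⟩
    · exact (he.const_smul c).trans (Lp.coeFn_smul c ψ).symm
    · rw [map_smul]
      exact hr.const_smul c

/-- The Dirac operator `H^Λ` with the point interaction `ψ(0+) = Λ ψ(0-)`. -/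
def pointDirac (M : ℝ) (Λ : Matrix (Fin 2) (Fin 2) ℂ) : L2 →ₗ.[ℂ] L2 :=
  (maxDirac M).domRestrict (pointDomain Λ)

theorem pointDirac_domain (M : ℝ) (Λ : Matrix (Fin 2) (Fin 2) ℂ) :
    (pointDirac M Λ).domain = pointDomain Λ :=
  inf_eq_left.2 fun _ h => h.1

/-- `R = (T - z)⁻¹`: the bounded operator `R` is the two-sided inverse of
`T - z : Dom(T) → L²(ℝ; ℂ²)`. -/
def IsResolventAt (T : L2 →ₗ.[ℂ] L2) (z : ℂ) (R : L2 →L[ℂ] L2) : Prop :=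
  (∀ f : L2, ∃ hf : R f ∈ T.domain, T ⟨R f, hf⟩ - z • R f = f) ∧
    ∀ ψ : T.domain, R (T ψ - z • (ψ : L2)) = ψ

/-- The matrices `A = iφI` with `φ ≠ 0` and `φ ≠ (2k+1)π`, `k ∈ ℤ`, and
`A = [[a, ib], [ic, -a]]` with `a, b, c` real and `det A ≠ ((2k+1)π)²`, `k ∈ ℕ₀`. -/
def Admissible (A : Matrix (Fin 2) (Fin 2) ℂ) : Prop :=
  (∃ φ : ℝ, φ ≠ 0 ∧ (∀ k : ℤ, φ ≠ (2 * k + 1) * Real.pi) ∧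
      A = (Complex.I * φ) • (1 : Matrix (Fin 2) (Fin 2) ℂ)) ∨
    ((∃ a b c : ℝ, A = !![(a : ℂ), Complex.I * b; Complex.I * c, -a]) ∧
      ∀ k : ℕ, A.det ≠ (((2 * k + 1) * Real.pi : ℝ) : ℂ) ^ 2)

end DiracPoint

end

/-! The potential is removed by a gauge transformation. Put `s_ε(x) = ∫_{-∞}^{x/ε} h` and `G_ε =
exp(s_ε A)`, so that `G_ε' = h_ε A G_ε`. For `ψ = G_ε φ` the product rule gives `ψ' - h_ε A ψ = G_ε
φ'`, hence `H_ε^A = -i σ₁ G_ε (d/dx) G_ε⁻¹ + M σ₃`. The point interaction has the same form with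
`s_ε` replaced by the Heaviside function: multiplying by `exp(-A)` on the right half-line removes
the jump, and a function continuous across the origin has no singular contribution to its derivative
there. All the operators thus come from the single space `W^{1,2}(ℝ)` and differ only in the gauge.

Admissible matrices satisfy `A* σ₁ = -σ₁ A`, which gives `G* σ₁ G = σ₁`. The gauge therefore
preserves the form `⟨σ₁ ·, ·⟩`, and self-adjointness reduces to maximal skew-symmetry of the weak
derivative on the line (`isSelfAdjointRel_gaugeRel`). Resolvents at `±i` then exist by the usual
closed-range argument (`IsSelfAdjointRel.exists_resolvent`), carried out on graphs so that no domain
has to be tracked.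

For two gauges `Γ, Γ₀`, the sesquilinear form of the resolvent difference consists of two terms,
each with a factor `Γ - Γ₀` applied to an element of `W^{1,2}` (`norm_resolvent_sub_le`). It remains
to see that `G_ε` tends to the sharp gauge as a map from `W^{1,2}` to `L²`
(`eventually_norm_mulOp_sub_le`): the two are uniformly close outside an interval of length `O(ε)`,
and on that interval elements of `W^{1,2}` are bounded. -/

noncomputable section

namespace DiracPoint

/-! ### Absolute continuity, primitives and integration by parts. -/

section AbsolutelyContinuous

variable {X Y Z : Type*} [PseudoMetricSpace X] [PseudoMetricSpace Y] [PseudoMetricSpace Z]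

/-- Absolute continuity sees only sums of increments, so domination of increments suffices. Two
dominating functions are allowed because the increment of a product involves both factors. -/
theorem absolutelyContinuousOnInterval_of_dist_le {f : ℝ → X} {u : ℝ → Y} {v : ℝ → Z} {a b K : ℝ}
    (hu : AbsolutelyContinuousOnInterval u a b) (hv : AbsolutelyContinuousOnInterval v a b)
    (hf : ∀ x ∈ Set.uIcc a b, ∀ y ∈ Set.uIcc a b,
      dist (f x) (f y) ≤ K * (dist (u x) (u y) + dist (v x) (v y))) :
    AbsolutelyContinuousOnInterval f a b := by
  have hlim := (Filter.Tendsto.add hu hv).const_mul K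
  simp only [add_zero, mul_zero] at hlim
  refine squeeze_zero' (Eventually.of_forall fun _ => Finset.sum_nonneg fun _ _ => dist_nonneg)
    ?_ hlim
  have hmem : ∀ᶠ E in AbsolutelyContinuousOnInterval.totalLengthFilter ⊓
      𝓟 (AbsolutelyContinuousOnInterval.disjWithin a b),
      E ∈ AbsolutelyContinuousOnInterval.disjWithin a b :=
    mem_inf_of_right (mem_principal_self _)
  filter_upwards [hmem] with E hE
  rw [← Finset.sum_add_distrib, Finset.mul_sum]
  exact Finset.sum_le_sum fun i hi => hf _ (hE.1 i hi).1 _ (hE.1 i hi).2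

end AbsolutelyContinuous

theorem intervalIntegrable_of_locallyIntegrable {E : Type*} [NormedAddCommGroup E] {w : ℝ → E}
    (hw : LocallyIntegrable w) (a b : ℝ) : IntervalIntegrable w volume a b :=
  (hw.integrableOn_isCompact isCompact_uIcc).intervalIntegrable

section Primitive

variable {E F G : Type*} [NormedAddCommGroup E] [NormedSpace ℝ E]
  [NormedAddCommGroup F] [NormedSpace ℝ F]
  [NormedAddCommGroup G] [NormedSpace ℝ G]

/-- `f` is a primitive of the locally integrable function `w`. -/
structure IsPrimitive (f w : ℝ → E) : Prop where
  locallyIntegrable : LocallyIntegrable w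
  sub_eq : ∀ a b, f b - f a = ∫ x in a..b, w x


theorem IsPrimitive.intervalIntegrable {f w : ℝ → E} (h : IsPrimitive f w) (a b : ℝ) :
    IntervalIntegrable w volume a b :=
  intervalIntegrable_of_locallyIntegrable h.locallyIntegrable a b

theorem IsPrimitive.absolutelyContinuousOnInterval {f w : ℝ → E} (h : IsPrimitive f w) (a b : ℝ) :
    AbsolutelyContinuousOnInterval f a b := by
  have hN := (h.intervalIntegrable a b).norm.absolutelyContinuousOnInterval_intervalIntegral
    (c := a) (by simp)
  refine absolutelyContinuousOnInterval_of_dist_le (K := 1) hN hN fun x _ y _ => ?_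
  have hi := fun s t => (h.intervalIntegrable s t).norm
  have h1 : dist (f x) (f y) ≤ dist (∫ v in a..x, ‖w v‖) (∫ v in a..y, ‖w v‖) := by
    rw [dist_comm, dist_eq_norm, h.sub_eq, dist_comm, Real.dist_eq,
      intervalIntegral.integral_interval_sub_left (hi _ _) (hi _ _)]
    exact intervalIntegral.norm_integral_le_abs_integral_norm
  linarith [dist_nonneg (x := ∫ v in a..x, ‖w v‖) (y := ∫ v in a..y, ‖w v‖)]

theorem IsPrimitive.continuous {f w : ℝ → E} (h : IsPrimitive f w) : Continuous f := by
  rw [continuous_iff_continuousAt]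
  intro x
  refine (h.absolutelyContinuousOnInterval (x - 1) (x + 1)).continuousOn.continuousAt ?_
  rw [Set.uIcc_of_le (by linarith)]
  exact Icc_mem_nhds (by linarith) (by linarith)

theorem isPrimitive_intervalIntegral {w : ℝ → E} (hw : LocallyIntegrable w) (c : ℝ) :
    IsPrimitive (fun x => ∫ t in c..x, w t) w := by
  have hi := intervalIntegrable_of_locallyIntegrable hw
  exact ⟨hw, fun a b => intervalIntegral.integral_interval_sub_left (hi _ _) (hi _ _)⟩

/-- Subtracting the indefinite integral of `w` leaves an absolutely continuous function with zero
derivative almost everywhere, which is constant. -/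
theorem isPrimitive_of_ae_hasDerivAt [CompleteSpace E] {f w : ℝ → E} (hw : LocallyIntegrable w)
    (hf : ∀ a b, AbsolutelyContinuousOnInterval f a b) (hd : ∀ᵐ x, HasDerivAt f (w x) x) :
    IsPrimitive f w := by
  refine ⟨hw, fun a b => ?_⟩
  have hp := isPrimitive_intervalIntegral hw a
  obtain ⟨C, hC⟩ := ((hf a b).sub
    (hp.absolutelyContinuousOnInterval a b)).const_of_ae_hasDerivAt_zero (by
      filter_upwards [hd, _root_.LocallyIntegrable.ae_hasDerivAt_integral hw] with x hx hx' _
      simpa using! hx.sub (hx' a))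
  have ha := hC a (by simp)
  have hb := hC b (by simp)
  simp only [Pi.sub_apply, intervalIntegral.integral_same, sub_zero] at ha hb
  rw [ha, ← hb]
  abel

theorem IsPrimitive.ae_hasDerivAt [CompleteSpace E] {f w : ℝ → E} (h : IsPrimitive f w) :
    ∀ᵐ x, HasDerivAt f (w x) x := by
  filter_upwards [_root_.LocallyIntegrable.ae_hasDerivAt_integral h.locallyIntegrable] with x hx
  have he : f = fun x => f 0 + ∫ t in (0 : ℝ)..x, w t := by
    funext y
    rw [← h.sub_eq]; abel
  rw [he]
  exact (hx 0).const_add _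

/-- The product rule, for a general bounded bilinear map so that it covers scalar multiplication by
test functions, inner products, and operators applied to vectors. -/
theorem IsPrimitive.bilin [CompleteSpace E] [CompleteSpace F] [CompleteSpace G]
    {B : E × F → G} (hB : IsBoundedBilinearMap ℝ B)
    {f w : ℝ → E} {g v : ℝ → F} (hf : IsPrimitive f w) (hg : IsPrimitive g v) :
    IsPrimitive (fun x => B (f x, g x)) (fun x => B (f x, v x) + B (w x, g x)) := by
  obtain ⟨C, hC0, hC⟩ := hB.bound
  have hdist : ∀ x x' y y', dist (B (x, y)) (B (x', y')) ≤
      C * ‖x‖ * dist y y' + C * ‖y'‖ * dist x x' := by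
    intro x x' y y'
    have e : B (x, y) - B (x', y') = B (x, y - y') + B (x - x', y') := by
      rw [hB.map_sub_left, hB.map_sub_right]; abel
    rw [dist_eq_norm, e, dist_eq_norm, dist_eq_norm]
    refine (norm_add_le _ _).trans ?_
    nlinarith [hC x (y - y'), hC (x - x') y']
  refine isPrimitive_of_ae_hasDerivAt ?_ (fun a b => ?_) ?_
  · have hm : ∀ {p : ℝ → E} {q : ℝ → F}, AEStronglyMeasurable p volume →
        AEStronglyMeasurable q volume → AEStronglyMeasurable (fun x => B (p x, q x)) volume :=
      fun hp hq => hB.continuous.comp_aestronglyMeasurable (hp.prodMk hq)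
    have hmf := hf.continuous.aestronglyMeasurable (μ := volume)
    have hmg := hg.continuous.aestronglyMeasurable (μ := volume)
    have hmw := hf.locallyIntegrable.aestronglyMeasurable
    have hmv := hg.locallyIntegrable.aestronglyMeasurable
    rw [locallyIntegrable_iff]
    intro k hk
    obtain ⟨c₁, hc₁⟩ := hk.exists_bound_of_continuousOn hf.continuous.continuousOn
    obtain ⟨c₂, hc₂⟩ := hk.exists_bound_of_continuousOn hg.continuous.continuousOn
    refine Integrable.add ?_ ?_
    · refine Integrable.mono' ((hg.locallyIntegrable.integrableOn_isCompact hk).norm.const_mul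
        (C * c₁)) (hm hmf hmv).restrict ?_
      refine (ae_restrict_mem hk.measurableSet).mono fun x hx => (hC _ _).trans ?_
      gcongr
      exact hc₁ x hx
    · refine Integrable.mono' ((hf.locallyIntegrable.integrableOn_isCompact hk).norm.const_mul
        (C * c₂)) (hm hmw hmg).restrict ?_
      refine (ae_restrict_mem hk.measurableSet).mono fun x hx => (hC _ _).trans ?_
      calc C * ‖w x‖ * ‖g x‖ ≤ C * ‖w x‖ * c₂ := by gcongr; exact hc₂ x hx
        _ = C * c₂ * ‖w x‖ := by ring
  · obtain ⟨c₁, hc₁⟩ := isCompact_uIcc.exists_bound_of_continuousOn (s := Set.uIcc a b)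
      hf.continuous.continuousOn
    obtain ⟨c₂, hc₂⟩ := isCompact_uIcc.exists_bound_of_continuousOn (s := Set.uIcc a b)
      hg.continuous.continuousOn
    refine absolutelyContinuousOnInterval_of_dist_le (K := C * c₁ + C * c₂)
      (hf.absolutelyContinuousOnInterval a b) (hg.absolutelyContinuousOnInterval a b)
      fun x hx y hy => (hdist _ _ _ _).trans ?_
    have h1 := (norm_nonneg _).trans (hc₁ x hx)
    have h2 := (norm_nonneg _).trans (hc₂ x hx)
    have h3 : C * ‖f x‖ * dist (g x) (g y) ≤ C * c₁ * dist (g x) (g y) := by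
      gcongr; exact hc₁ x hx
    have h4 : C * ‖g y‖ * dist (f x) (f y) ≤ C * c₂ * dist (f x) (f y) := by
      gcongr; exact hc₂ y hy
    have h5 : 0 ≤ C * c₁ * dist (f x) (f y) := by positivity
    have h6 : 0 ≤ C * c₂ * dist (g x) (g y) := by positivity
    nlinarith
  · filter_upwards [hf.ae_hasDerivAt, hg.ae_hasDerivAt] with x hx hx'
    have := (hB.hasFDerivAt (f x, g x)).comp_hasDerivAt x (hx.prodMk hx')
    simpa using! this

theorem isPrimitive_deriv [CompleteSpace E] {f : ℝ → E} (hf : ContDiff ℝ 1 f) :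
    IsPrimitive f (deriv f) := by
  have hc : Continuous (deriv f) := hf.continuous_deriv le_rfl
  refine ⟨hc.locallyIntegrable, fun a b => ?_⟩
  rw [intervalIntegral.integral_deriv_eq_sub
    (fun x _ => (hf.differentiable (by simp)).differentiableAt) (hc.intervalIntegrable a b)]

/-- A primitive which vanishes outside a compact set integrates its derivative to zero. -/
theorem IsPrimitive.integral_eq_zero {f w : ℝ → E} (h : IsPrimitive f w) {k : Set ℝ}
    (hk : IsCompact k) (hf : ∀ x ∉ k, f x = 0) (hw : ∀ x ∉ k, w x = 0) : ∫ x, w x = 0 := by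
  obtain ⟨R, hR⟩ := hk.isBounded.subset_ball 0
  rw [Real.ball_eq_Ioo] at hR
  have hs : Function.support w ⊆ Set.Ioc (0 - R) (0 + R) := fun x hx =>
    Set.Ioo_subset_Ioc_self (hR (by by_contra hx'; exact hx (hw x hx')))
  rw [← intervalIntegral.integral_eq_integral_of_support_subset hs, ← h.sub_eq,
    hf _ fun hx => lt_irrefl _ (hR hx).1, hf _ fun hx => lt_irrefl _ (hR hx).2, sub_zero]

/-- Integration by parts: `φ f` is a primitive vanishing off the support of `φ`, so its derivative
has integral zero. -/
theorem IsPrimitive.integral_deriv_smul [CompleteSpace E] {f w : ℝ → E} (h : IsPrimitive f w)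
    {φ : ℝ → ℝ} (hφ : ContDiff ℝ 1 φ) (hc : HasCompactSupport φ) :
    ∫ x, deriv φ x • f x = - ∫ x, φ x • w x := by
  have hp := (isPrimitive_deriv hφ).bilin (B := fun p : ℝ × E => p.1 • p.2)
    isBoundedBilinearMap_smul h
  have hz := hp.integral_eq_zero (k := tsupport φ) hc
    (fun x hx => by simp [image_eq_zero_of_notMem_tsupport hx])
    (fun x hx => by
      have h2 : deriv φ x = 0 :=
        image_eq_zero_of_notMem_tsupport fun hx' => hx (tsupport_deriv_subset hx')
      simp [image_eq_zero_of_notMem_tsupport hx, h2])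
  have hi1 : Integrable fun x => φ x • w x :=
    h.locallyIntegrable.integrable_smul_left_of_hasCompactSupport hφ.continuous hc
  have hi2 : Integrable fun x => deriv φ x • f x :=
    h.continuous.locallyIntegrable.integrable_smul_left_of_hasCompactSupport
      (hφ.continuous_deriv le_rfl) hc.deriv
  rw [integral_add hi1 hi2] at hz
  exact eq_neg_of_add_eq_zero_right hz

end Primitive

/-! ### The lemma of du Bois-Reymond. -/

section DuBoisReymond

variable {E : Type*} [NormedAddCommGroup E] [NormedSpace ℝ E] [CompleteSpace E]

/-- Integrating from the left of the support gives a function that is zero on the left, and zero on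
the right because the total integral is zero. -/
theorem exists_primitive_of_integral_eq_zero {κ : ℝ → ℝ} (hκ : ContDiff ℝ ∞ κ)
    (hc : HasCompactSupport κ) (h0 : ∫ x, κ x = 0) :
    ∃ φ : ℝ → ℝ, ContDiff ℝ ∞ φ ∧ HasCompactSupport φ ∧ deriv φ = κ := by
  obtain ⟨R, hR⟩ := hc.isBounded.subset_ball 0
  rw [Real.ball_eq_Ioo] at hR
  have hd : ∀ x, HasDerivAt (fun x => ∫ t in (0 - R)..x, κ t) (κ x) x := fun x =>
    intervalIntegral.integral_hasDerivAt_right (hκ.continuous.intervalIntegrable _ _)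
      (hκ.continuous.stronglyMeasurableAtFilter _ _) hκ.continuous.continuousAt
  have hd' : deriv (fun x => ∫ t in (0 - R)..x, κ t) = κ := funext fun x => (hd x).deriv
  have hz : ∀ x, x ∉ Set.Ioo (0 - R) (0 + R) → κ x = 0 := fun x hx =>
    image_eq_zero_of_notMem_tsupport fun hx' => hx (hR hx')
  refine ⟨_, ?_, ?_, hd'⟩
  · rw [contDiff_infty_iff_deriv, hd']
    exact ⟨fun x => (hd x).differentiableAt, hκ⟩
  · refine HasCompactSupport.intro (isCompact_Icc (a := 0 - R) (b := 0 + R)) fun x hx => ?_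
    rcases lt_or_ge x (0 - R) with hlt | hge
    · refine intervalIntegral.integral_zero_ae (Eventually.of_forall fun t ht => hz t ?_)
      rw [Set.uIoc_of_ge hlt.le] at ht
      exact fun h => absurd h.1 (not_lt.2 ht.2)
    · have hgt : 0 + R < x := by
        by_contra hle
        exact hx ⟨hge, not_lt.1 hle⟩
      rw [intervalIntegral.integral_eq_integral_of_support_subset, h0]
      intro t ht
      have ht' : t ∈ Set.Ioo (0 - R) (0 + R) := by
        by_contra hn
        exact ht (hz t hn)
      exact ⟨ht'.1, (ht'.2.trans hgt).le⟩

/-- The lemma of du Bois-Reymond on the line. -/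
theorem ae_eq_const_of_integral_deriv_smul_eq_zero {v : ℝ → E} (hv : LocallyIntegrable v)
    (h : ∀ φ : ℝ → ℝ, ContDiff ℝ ∞ φ → HasCompactSupport φ → ∫ x, deriv φ x • v x = 0) :
    ∃ c : E, ∀ᵐ x, v x = c := by
  let b : ContDiffBump (0 : ℝ) := ⟨1, 2, by norm_num, by norm_num⟩
  let ρ : ℝ → ℝ := b.normed volume
  have hρ : ContDiff ℝ ∞ ρ := b.contDiff_normed
  have hρc : HasCompactSupport ρ := b.hasCompactSupport_normed
  have hρ1 : ∫ x, ρ x = 1 := b.integral_normed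
  have hint : ∀ {ψ : ℝ → ℝ}, ContDiff ℝ ∞ ψ → HasCompactSupport ψ → ∀ {g : ℝ → E},
      LocallyIntegrable g → Integrable fun x => ψ x • g x := fun hψ hc _ hg =>
    hg.integrable_smul_left_of_hasCompactSupport hψ.continuous hc
  have hint' : ∀ {ψ : ℝ → ℝ}, ContDiff ℝ ∞ ψ → HasCompactSupport ψ → Integrable ψ :=
    fun hψ hc => hψ.continuous.integrable_of_hasCompactSupport hc
  refine ⟨∫ x, ρ x • v x, ?_⟩
  have hcl : LocallyIntegrable fun _ : ℝ => ∫ x, ρ x • v x :=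
    continuous_const.locallyIntegrable
  have key := ae_eq_zero_of_integral_contDiff_smul_eq_zero (μ := (volume : Measure ℝ))
    (hv.sub hcl) (fun ψ hψ hψc => by
      let s := ∫ x, ψ x
      -- Removing `(∫ ψ) ρ` from `ψ` makes the mean zero, so the difference is the derivative of a
      -- test function and `v` integrates to zero against it.
      have hκ : ContDiff ℝ ∞ (fun x => ψ x - s * ρ x) := hψ.sub (contDiff_const.mul hρ)
      have hκc : HasCompactSupport (fun x => ψ x - s * ρ x) := hψc.sub hρc.mul_left
      obtain ⟨φ, hφ, hφc, hd⟩ := exists_primitive_of_integral_eq_zero hκ hκc (by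
        rw [integral_sub (hint' hψ hψc) ((hint' hρ hρc).const_mul s), integral_const_mul, hρ1]
        simp [s])
      have h1 := h φ hφ hφc
      simp only [hd, sub_smul, mul_smul] at h1
      have hs : Integrable fun x => s • ρ x • v x := (hint hρ hρc hv).smul s
      rw [integral_sub (hint hψ hψc hv) hs, integral_smul] at h1
      simp only [Pi.sub_apply, smul_sub]
      rw [integral_sub (hint hψ hψc hv) (hint hψ hψc hcl), integral_smul_const]
      exact h1)
  filter_upwards [key] with x hx
  exact sub_eq_zero.1 hx

end DuBoisReymond

/-! ### The weak derivative on the line: representatives, skew-symmetry, Sobolev bound. -/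

theorem locallyIntegrable_coe (f : L2) : LocallyIntegrable f :=
  (Lp.memLp f).locallyIntegrable (by norm_num)

theorem IsPrimitive.hasWeakDerivOn {f w : ℝ → Spinor} (h : IsPrimitive f w) (U : Set ℝ) :
    HasWeakDerivOn U f w := fun _ hφ hc _ =>
  h.integral_deriv_smul (hφ.of_le (by simp)) hc

theorem HasWeakDerivOn.congr {U : Set ℝ} {f f' w w' : ℝ → Spinor} (h : HasWeakDerivOn U f w)
    (hf : f =ᵐ[volume] f') (hw : w =ᵐ[volume] w') : HasWeakDerivOn U f' w' := by
  intro φ hφ hc hs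
  have e₁ : (fun x => deriv φ x • f x) =ᵐ[volume] fun x => deriv φ x • f' x :=
    hf.mono fun x hx => congrArg (deriv φ x • ·) hx
  have e₂ : (fun x => φ x • w x) =ᵐ[volume] fun x => φ x • w' x :=
    hw.mono fun x hx => congrArg (φ x • ·) hx
  rw [← integral_congr_ae e₁, ← integral_congr_ae e₂, h φ hφ hc hs]

/-- A function with a weak derivative on the line has an absolutely continuous representative. -/
theorem HasWeakDerivOn.exists_isPrimitive {u w : ℝ → Spinor}
    (h : HasWeakDerivOn Set.univ u w) (hu : LocallyIntegrable u) (hw : LocallyIntegrable w) :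
    ∃ f, f =ᵐ[volume] u ∧ IsPrimitive f w := by
  have hp := isPrimitive_intervalIntegral hw 0
  obtain ⟨c, hc⟩ := ae_eq_const_of_integral_deriv_smul_eq_zero
    (hu.sub hp.continuous.locallyIntegrable) (fun φ hφ hφc => by
      have hd : Continuous (deriv φ) := hφ.continuous_deriv (by simp)
      simp only [Pi.sub_apply, smul_sub]
      rw [integral_sub (hu.integrable_smul_left_of_hasCompactSupport hd hφc.deriv)
        (hp.continuous.locallyIntegrable.integrable_smul_left_of_hasCompactSupport hd hφc.deriv),
        h φ hφ hφc (Set.subset_univ _), hp.hasWeakDerivOn Set.univ φ hφ hφc (Set.subset_univ _),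
        sub_self])
  refine ⟨fun x => c + ∫ t in (0 : ℝ)..x, w t, ?_, hw, fun a b => ?_⟩
  · filter_upwards [hc] with x hx
    rw [← hx, Pi.sub_apply, sub_add_cancel]
  · rw [add_sub_add_left_eq_sub, hp.sub_eq]

/-- Integrability of `w` gives `f` limits at both ends, and integrability of `f` forces these limits
to vanish. -/
theorem IsPrimitive.integral_eq_zero_of_integrable {E : Type*} [NormedAddCommGroup E]
    [NormedSpace ℝ E] {f w : ℝ → E} (h : IsPrimitive f w) (hf : Integrable f)
    (hw : Integrable w) : ∫ x, w x = 0 := by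
  have htop : Tendsto f atTop (𝓝 (f 0 + ∫ x in Set.Ioi 0, w x)) := by
    refine ((intervalIntegral_tendsto_integral_Ioi 0 hw.integrableOn tendsto_id).const_add
      (f 0)).congr fun x => ?_
    rw [id, ← h.sub_eq]; abel
  have hbot : Tendsto f atBot (𝓝 (f 0 - ∫ x in Set.Iic 0, w x)) := by
    refine ((intervalIntegral_tendsto_integral_Iic 0 hw.integrableOn tendsto_id).const_sub
      (f 0)).congr fun x => ?_
    rw [id, ← h.sub_eq]; abel
  have h1 := (hf.integrableAtFilter atTop).eq_zero_of_tendsto (fun s hs => by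
    obtain ⟨a, ha⟩ := mem_atTop_sets.1 hs
    exact measure_mono_top (s₁ := Set.Ici a) ha (by simp)) htop
  have h2 := (hf.integrableAtFilter atBot).eq_zero_of_tendsto (fun s hs => by
    obtain ⟨a, ha⟩ := mem_atBot_sets.1 hs
    exact measure_mono_top (s₁ := Set.Iic a) ha (by simp)) hbot
  rw [← intervalIntegral.integral_Iic_add_Ioi hw.integrableOn hw.integrableOn (b := 0)]
  have h3 : f 0 = ∫ x in Set.Iic 0, w x := sub_eq_zero.1 h2
  rw [← h3, h1]

/-- The weak derivative on the line is skew-symmetric. -/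
theorem HasWeakDerivOn.inner_eq_neg {u w u' w' : L2} (h : HasWeakDerivOn Set.univ u w)
    (h' : HasWeakDerivOn Set.univ u' w') : inner ℂ u w' = - inner ℂ w u' := by
  obtain ⟨f, hfu, hf⟩ := h.exists_isPrimitive (locallyIntegrable_coe u) (locallyIntegrable_coe w)
  obtain ⟨f', hfu', hf'⟩ := h'.exists_isPrimitive (locallyIntegrable_coe u')
    (locallyIntegrable_coe w')
  have hp := hf.bilin (B := fun p : Spinor × Spinor => inner ℂ p.1 p.2)
    (isBoundedBilinearMap_inner (𝕜 := ℂ)) hf'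
  have e₀ : (fun x => inner ℂ (u x) (u' x)) =ᵐ[volume] fun x => inner ℂ (f x) (f' x) := by
    filter_upwards [hfu, hfu'] with x h1 h2
    rw [h1, h2]
  have e₁ : (fun x => inner ℂ (u x) (w' x)) =ᵐ[volume] fun x => inner ℂ (f x) (w' x) := by
    filter_upwards [hfu] with x h1
    rw [h1]
  have e₂ : (fun x => inner ℂ (w x) (u' x)) =ᵐ[volume] fun x => inner ℂ (w x) (f' x) := by
    filter_upwards [hfu'] with x h1
    rw [h1]
  have i₁ := (L2.integrable_inner (𝕜 := ℂ) u w').congr e₁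
  have i₂ := (L2.integrable_inner (𝕜 := ℂ) w u').congr e₂
  have hz := hp.integral_eq_zero_of_integrable ((L2.integrable_inner u u').congr e₀) (i₁.add i₂)
  rw [integral_add i₁ i₂] at hz
  rw [L2.inner_def, L2.inner_def, integral_congr_ae e₁, integral_congr_ae e₂]
  exact eq_neg_of_add_eq_zero_left hz

/-- The weak derivative on the line is maximal among skew-symmetric relations. -/
theorem hasWeakDerivOn_univ_of_inner_eq_neg {u w : L2}
    (h : ∀ u' w' : L2, HasWeakDerivOn Set.univ u' w' → inner ℂ u w' = - inner ℂ w u') :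
    HasWeakDerivOn Set.univ u w := by
  intro φ hφ hc _
  have hd : Continuous (deriv φ) := hφ.continuous_deriv (by simp)
  refine ext_inner_left ℂ fun e => ?_
  have m₀ : MemLp (fun x => φ x • e) 2 volume :=
    (hφ.continuous.smul continuous_const).memLp_of_hasCompactSupport hc.smul_right
  have m₁ : MemLp (fun x => deriv φ x • e) 2 volume :=
    (hd.smul continuous_const).memLp_of_hasCompactSupport hc.deriv.smul_right
  have hp : IsPrimitive (fun x => φ x • e) (fun x => deriv φ x • e) := by
    have := (isPrimitive_deriv (hφ.of_le (by simp))).bilin (B := fun p : ℝ × Spinor => p.1 • p.2)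
      isBoundedBilinearMap_smul (g := fun _ => e) (v := fun _ => 0)
      ⟨locallyIntegrable_zero, fun a b => by simp⟩
    simpa using this
  -- The vector `e` is arbitrary, so the functions `φ • e` in `W^{1,2}` recover the vector-valued
  -- identity from scalar ones.
  have key := h (m₀.toLp _) (m₁.toLp _)
    ((hp.hasWeakDerivOn _).congr m₀.coeFn_toLp.symm m₁.coeFn_toLp.symm)
  have aux : ∀ (v : L2) {ψ : ℝ → ℝ} (hψ : Continuous ψ) (hψc : HasCompactSupport ψ)
      (m : MemLp (fun x => ψ x • e) 2 volume),
      inner ℂ (m.toLp _) v = inner ℂ e (∫ x, ψ x • v x) := by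
    intro v ψ hψ hψc m
    rw [L2.inner_def, ← integral_inner (integrable_test_smul hψ hψc v)]
    refine integral_congr_ae ?_
    filter_upwards [m.coeFn_toLp] with x hx
    rw [hx, ← Complex.coe_smul, ← Complex.coe_smul, inner_smul_left, inner_smul_right,
      Complex.conj_ofReal]
  have key' := congrArg (starRingEnd ℂ) key
  rw [map_neg, inner_conj_symm, inner_conj_symm, aux _ hd hc.deriv, aux _ hφ.continuous hc,
    ← inner_neg_right] at key'
  exact key'

/-- A unit interval carries a probability measure, for which the `L¹` norm is at most the `L²` norm.
-/
theorem setIntegral_norm_le (u : L2) (x : ℝ) : ∫ t in x..x + 1, ‖u t‖ ≤ ‖u‖ := by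
  rw [intervalIntegral.integral_of_le (by linarith), Lp.norm_def]
  have hm := (Lp.aestronglyMeasurable u).restrict (s := Set.Ioc x (x + 1))
  have hprob : IsProbabilityMeasure (volume.restrict (Set.Ioc x (x + 1))) := ⟨by simp⟩
  rw [integral_norm_eq_lintegral_enorm hm, ← eLpNorm_one_eq_lintegral_enorm]
  refine ENNReal.toReal_mono (Lp.eLpNorm_ne_top u) ?_
  exact (eLpNorm_le_eLpNorm_of_exponent_le (by norm_num) hm).trans
    (eLpNorm_mono_measure _ Measure.restrict_le_self)

/-- The one-dimensional Sobolev embedding into bounded functions. -/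
theorem HasWeakDerivOn.ae_norm_le {u w : L2} (h : HasWeakDerivOn Set.univ u w) :
    ∀ᵐ x, ‖u x‖ ≤ ‖u‖ + ‖w‖ := by
  obtain ⟨f, hfu, hf⟩ := h.exists_isPrimitive (locallyIntegrable_coe u) (locallyIntegrable_coe w)
  filter_upwards [hfu] with x hx
  rw [← hx]
  have hle : x ≤ x + 1 := by linarith
  have hi := (hf.intervalIntegrable x (x + 1)).norm
  have h1 : ∀ y ∈ Set.Icc x (x + 1), ‖f x‖ ≤ ‖f y‖ + ∫ t in x..x + 1, ‖w t‖ := by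
    intro y hy
    have h2 : ‖f y - f x‖ ≤ ∫ t in x..y, ‖w t‖ := by
      rw [hf.sub_eq]
      exact intervalIntegral.norm_integral_le_integral_norm hy.1
    have h3 : ∫ t in x..y, ‖w t‖ ≤ ∫ t in x..x + 1, ‖w t‖ :=
      intervalIntegral.integral_mono_interval le_rfl hy.1 hy.2
        (Eventually.of_forall fun _ => norm_nonneg _) hi
    have h4 : ‖f x‖ ≤ ‖f y‖ + ‖f y - f x‖ := by
      rw [norm_sub_rev]
      exact norm_le_norm_add_norm_sub' _ _
    linarith
  have hfi : IntervalIntegrable (fun y => ‖f y‖) volume x (x + 1) :=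
    hf.continuous.norm.intervalIntegrable _ _
  -- Averaging `h1` over a unit interval replaces the pointwise value `‖f y‖` by an `L¹` mean,
  -- controlled by the `L²` norm.
  have h5 := intervalIntegral.integral_mono_on hle intervalIntegrable_const
    (hfi.add intervalIntegrable_const) h1
  rw [intervalIntegral.integral_add hfi intervalIntegrable_const] at h5
  simp only [intervalIntegral.integral_const, add_sub_cancel_left, one_smul] at h5
  have h6 : ∫ y in x..x + 1, ‖f y‖ = ∫ y in x..x + 1, ‖u y‖ :=
    intervalIntegral.integral_congr_ae (hfu.mono fun y hy _ => by rw [hy])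
  rw [h6] at h5
  linarith [setIntegral_norm_le u x, setIntegral_norm_le w x]

/-! ### Self-adjoint linear relations and their resolvents. -/

section Relation

variable {H : Type*} [NormedAddCommGroup H] [InnerProductSpace ℂ H]

/-- A self-adjoint linear relation. -/
structure IsSelfAdjointRel (T : Submodule ℂ (H × H)) : Prop where
  symm : ∀ p ∈ T, ∀ q ∈ T, inner ℂ p.1 q.2 = inner ℂ p.2 q.1
  maximal : ∀ p : H × H, (∀ q ∈ T, inner ℂ p.1 q.2 = inner ℂ p.2 q.1) → p ∈ T

/-- `R` is the resolvent of the linear relation `T` at `z`. -/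
structure IsRelResolventAt (T : Submodule ℂ (H × H)) (z : ℂ) (R : H →L[ℂ] H) : Prop where
  mem : ∀ f, (R f, f + z • R f) ∈ T
  apply_eq : ∀ p ∈ T, R (p.2 - z • p.1) = p.1

variable {T : Submodule ℂ (H × H)}

theorem IsSelfAdjointRel.isClosed (hT : IsSelfAdjointRel T) : IsClosed (T : Set (H × H)) := by
  have : (T : Set (H × H)) = ⋂ q ∈ T, {p | inner ℂ p.1 q.2 = inner ℂ p.2 q.1} := by
    ext p
    simp only [Set.mem_iInter]
    exact ⟨fun hp q hq => hT.symm p hp q hq, fun h => hT.maximal p h⟩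
  rw [this]
  exact isClosed_biInter fun q _ => isClosed_eq (by fun_prop) (by fun_prop)

/-- The cross term is the real part of `z ⟨p.2, p.1⟩`; it vanishes because the inner product is real
and `z` is imaginary. -/
theorem IsSelfAdjointRel.norm_sub_sq (hT : IsSelfAdjointRel T) {z : ℂ} (hre : z.re = 0)
    (hz : ‖z‖ = 1) {p : H × H} (hp : p ∈ T) :
    ‖p.2 - z • p.1‖ ^ 2 = ‖p.2‖ ^ 2 + ‖p.1‖ ^ 2 := by
  have him : (inner ℂ p.2 p.1 : ℂ).im = 0 := by
    rw [← Complex.conj_eq_iff_im, inner_conj_symm, hT.symm p hp p hp]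
  have h := @_root_.norm_sub_sq ℂ H _ _ _ p.2 (z • p.1)
  rw [h, inner_smul_right, norm_smul, hz, one_mul]
  simp [hre, him]

theorem IsSelfAdjointRel.norm_le (hT : IsSelfAdjointRel T) {z : ℂ} (hre : z.re = 0)
    (hz : ‖z‖ = 1) {p : H × H} (hp : p ∈ T) :
    ‖p.1‖ ≤ ‖p.2 - z • p.1‖ ∧ ‖p.2‖ ≤ ‖p.2 - z • p.1‖ := by
  have h := hT.norm_sub_sq hre hz hp
  constructor <;> refine le_of_sq_le_sq ?_ (norm_nonneg _) <;> rw [h] <;>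
    nlinarith [sq_nonneg ‖p.1‖, sq_nonneg ‖p.2‖]

/-- The norm bound makes the range closed. A vector `v` orthogonal to it satisfies `(v, z̄ v) ∈ T`
by maximality, and symmetry excludes the non-real eigenvalue `z̄` unless `v = 0`. -/
theorem IsSelfAdjointRel.surjective [CompleteSpace H] (hT : IsSelfAdjointRel T) {z : ℂ}
    (hre : z.re = 0) (hz : ‖z‖ = 1) (f : H) : ∃ p ∈ T, p.2 - z • p.1 = f := by
  let L : T →L[ℂ] H :=
    (ContinuousLinearMap.snd ℂ H H - z • ContinuousLinearMap.fst ℂ H H).comp T.subtypeL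
  have hLa : ∀ p : T, L p = (p : H × H).2 - z • (p : H × H).1 := fun p => rfl
  have hanti : AntilipschitzWith 1 L := AddMonoidHomClass.antilipschitz_of_bound L fun p => by
    have := hT.norm_le hre hz p.2
    rw [hLa, NNReal.coe_one, one_mul, Submodule.coe_norm, Prod.norm_def]
    exact max_le this.1 this.2
  have : CompleteSpace T := hT.isClosed.completeSpace_coe
  have hcl : IsClosed (Set.range L) := hanti.isClosed_range L.uniformContinuous
  let S : Submodule ℂ H := LinearMap.range (L : T →ₗ[ℂ] H)
  have hS : IsClosed (S : Set H) := by simpa [S, LinearMap.coe_range] using hcl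
  have : CompleteSpace S := hS.completeSpace_coe
  have htop : S = ⊤ := by
    rw [← Submodule.orthogonal_eq_bot_iff, Submodule.eq_bot_iff]
    intro v hv
    have h1 : ∀ q ∈ T, inner ℂ v q.2 = inner ℂ ((starRingEnd ℂ z) • v) q.1 := by
      intro q hq
      have h2 : inner ℂ v (q.2 - z • q.1) = 0 :=
        (Submodule.mem_orthogonal' S v).1 hv _ ⟨⟨q, hq⟩, rfl⟩
      rw [inner_sub_right, inner_smul_right, sub_eq_zero] at h2
      rw [h2, inner_smul_left, Complex.conj_conj]
    have h3 := hT.maximal (v, (starRingEnd ℂ z) • v) h1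
    have h4 := (hT.symm _ h3 _ h3)
    simp only [inner_smul_left, inner_smul_right, Complex.conj_conj] at h4
    have h5 : (starRingEnd ℂ z) - z ≠ 0 := by
      intro h
      have him : z.im = 0 := by
        have := congrArg Complex.im h
        simp at this
        linarith
      have : z = 0 := Complex.ext hre him
      simp [this] at hz
    have h6 : (starRingEnd ℂ z - z) * inner ℂ v v = 0 := by rw [sub_mul, h4, sub_self]
    exact inner_self_eq_zero.1 ((mul_eq_zero.1 h6).resolve_left h5)
  obtain ⟨p, hp⟩ : f ∈ S := htop ▸ Submodule.mem_top
  exact ⟨p, p.2, hp⟩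

theorem IsSelfAdjointRel.exists_resolvent [CompleteSpace H] (hT : IsSelfAdjointRel T) {z : ℂ}
    (hre : z.re = 0) (hz : ‖z‖ = 1) : ∃ R : H →L[ℂ] H, IsRelResolventAt T z R := by
  choose p hpT hp using hT.surjective hre hz
  have huniq : ∀ q ∈ T, ∀ q' ∈ T, q.2 - z • q.1 = q'.2 - z • q'.1 → q.1 = q'.1 := by
    intro q hq q' hq' h
    have h1 := (hT.norm_le hre hz (T.sub_mem hq hq')).1
    have h2 : (q - q').2 - z • (q - q').1 = 0 := by
      rw [Prod.snd_sub, Prod.fst_sub, smul_sub, sub_sub_sub_comm, h, sub_self]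
    rw [h2, norm_zero, norm_le_zero_iff, Prod.fst_sub, sub_eq_zero] at h1
    exact h1
  let L : H →ₗ[ℂ] H :=
    { toFun := fun f => (p f).1
      map_add' := fun f g => huniq (p (f + g)) (hpT _) (p f + p g) (T.add_mem (hpT f) (hpT g)) (by
        rw [hp, Prod.snd_add, Prod.fst_add, smul_add, add_sub_add_comm, hp, hp])
      map_smul' := fun c f => huniq (p (c • f)) (hpT _) (c • p f) (T.smul_mem c (hpT f)) (by
        rw [hp, Prod.smul_snd, Prod.smul_fst, smul_comm z c, ← smul_sub, hp]) }
  refine ⟨L.mkContinuous 1 fun f => ?_, fun f => ?_, fun q hq => ?_⟩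
  · have := (hT.norm_le hre hz (hpT f)).1
    rwa [hp, ← one_mul ‖f‖] at this
  · have h1 : f + z • (p f).1 = (p f).2 := by
      nth_rewrite 1 [← hp f]
      abel
    change ((p f).1, f + z • (p f).1) ∈ T
    rw [h1]
    exact hpT f
  · exact huniq _ (hpT _) q hq (hp _)

end Relation

/-! ### Abstract gauge transforms of a Dirac operator. -/

section Gauge

variable {H : Type*} [NormedAddCommGroup H] [InnerProductSpace ℂ H]

/-- An abstract derivative `D`, a commuting self-adjoint involution `J` and a bounded
self-adjoint operator `V`. -/
structure IsDiracSystem (D : Submodule ℂ (H × H)) (J V : H →L[ℂ] H) : Prop where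
  skew : ∀ p ∈ D, ∀ q ∈ D, inner ℂ p.1 q.2 = - inner ℂ p.2 q.1
  maximal : ∀ p : H × H, (∀ q ∈ D, inner ℂ p.1 q.2 = - inner ℂ p.2 q.1) → p ∈ D
  inner_J : ∀ x y, inner ℂ (J x) y = inner ℂ x (J y)
  J_J : ∀ x, J (J x) = x
  map_J : ∀ p ∈ D, (J p.1, J p.2) ∈ D
  inner_V : ∀ x y, inner ℂ (V x) y = inner ℂ x (V y)

/-- `Γ` and its adjoint `Γ'` preserve the form of `J`. -/
structure IsGauge (J Γ Γ' : H →L[ℂ] H) : Prop where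
  inner_eq : ∀ x y, inner ℂ (Γ x) y = inner ℂ x (Γ' y)
  adjoint_J_self : ∀ x, Γ' (J (Γ x)) = J x
  self_J_adjoint : ∀ x, Γ (J (Γ' x)) = J x

/-- The relation of the operator `-i J Γ D Γ⁻¹ + V`. -/
def gaugeRel (D : Submodule ℂ (H × H)) (J V Γ : H →L[ℂ] H) : Submodule ℂ (H × H) :=
  D.map (((Γ.comp (ContinuousLinearMap.fst ℂ H H)).prod
    ((-Complex.I) • (J.comp (Γ.comp (ContinuousLinearMap.snd ℂ H H))) +
      V.comp (Γ.comp (ContinuousLinearMap.fst ℂ H H))) : H × H →L[ℂ] H × H) :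
      H × H →ₗ[ℂ] H × H)

theorem mem_gaugeRel {D : Submodule ℂ (H × H)} {J V Γ : H →L[ℂ] H} {p : H × H} :
    p ∈ gaugeRel D J V Γ ↔ ∃ φ w, (φ, w) ∈ D ∧ p.1 = Γ φ ∧
      p.2 = (-Complex.I) • J (Γ w) + V (Γ φ) := by
  constructor
  · rintro ⟨q, hq, rfl⟩
    exact ⟨q.1, q.2, hq, rfl, rfl⟩
  · rintro ⟨φ, w, h, h1, h2⟩
    exact ⟨(φ, w), h, Prod.ext h1.symm h2.symm⟩

variable {D : Submodule ℂ (H × H)} {J V Γ Γ' Γ₀ Γ₀' : H →L[ℂ] H}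

theorem IsDiracSystem.norm_J (hD : IsDiracSystem D J V) (x : H) : ‖J x‖ = ‖x‖ := by
  have h : inner ℂ (J x) (J x) = (inner ℂ x x : ℂ) := by rw [hD.inner_J, hD.J_J]
  rw [inner_self_eq_norm_sq_to_K, inner_self_eq_norm_sq_to_K] at h
  have h2 : ‖J x‖ ^ 2 = ‖x‖ ^ 2 := by exact_mod_cast h
  exact (sq_eq_sq₀ (norm_nonneg _) (norm_nonneg _)).1 h2

theorem IsGauge.left_inv (hD : IsDiracSystem D J V) (hΓ : IsGauge J Γ Γ') (x : H) :
    J (Γ' (J (Γ x))) = x := by rw [hΓ.adjoint_J_self, hD.J_J]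

theorem IsGauge.right_inv (hD : IsDiracSystem D J V) (hΓ : IsGauge J Γ Γ') (x : H) :
    Γ (J (Γ' (J x))) = x := by rw [hΓ.self_J_adjoint, hD.J_J]

/-- Since `⟨Γ x, J Γ y⟩ = ⟨J x, y⟩`, both symmetry and maximality are inherited from the skew
relation `D`. -/
theorem isSelfAdjointRel_gaugeRel (hD : IsDiracSystem D J V) (hΓ : IsGauge J Γ Γ') :
    IsSelfAdjointRel (gaugeRel D J V Γ) := by
  have hJ : ∀ x y, inner ℂ (Γ x) (J (Γ y)) = inner ℂ (J x) y := fun x y => by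
    rw [hΓ.inner_eq, hΓ.adjoint_J_self, hD.inner_J]
  constructor
  · intro p hp q hq
    obtain ⟨φ, w, h, h1, h2⟩ := mem_gaugeRel.1 hp
    obtain ⟨φ', w', h', h1', h2'⟩ := mem_gaugeRel.1 hq
    rw [h1, h2, h1', h2', inner_add_left, inner_add_right, inner_smul_left, inner_smul_right, hJ,
      hD.inner_J (Γ w), hJ, hD.inner_V]
    have := hD.skew _ (hD.map_J _ h) _ h'
    simp only at this
    rw [this]
    simp
  · intro p hp
    -- As `J Γ' J` inverts `Γ`, the preimage of `p` has to be `(J Γ' J p.1, i J Γ' (p.2 - V p.1))`.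
    -- Its image under `J` is what the pairing tests, and `map_J` then undoes the extra `J`.
    have key : (J (J (Γ' (J p.1))), Complex.I • Γ' (p.2 - V p.1)) ∈ D := by
      refine hD.maximal _ fun q hq => ?_
      have h := hp (Γ q.1, (-Complex.I) • J (Γ q.2) + V (Γ q.1))
        (mem_gaugeRel.2 ⟨q.1, q.2, hq, rfl, rfl⟩)
      simp only [inner_add_right, inner_smul_right] at h
      have e1 : inner ℂ p.1 (J (Γ q.2)) = inner ℂ (J (J (Γ' (J p.1)))) q.2 := by
        rw [hD.J_J, ← hD.inner_J, ← inner_conj_symm, hΓ.inner_eq, inner_conj_symm]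
      have e2 : inner ℂ (Γ' (p.2 - V p.1)) q.1 =
          inner ℂ p.2 (Γ q.1) - inner ℂ p.1 (V (Γ q.1)) := by
        rw [← inner_conj_symm, ← hΓ.inner_eq, inner_conj_symm, inner_sub_left, hD.inner_V]
      simp only [inner_smul_left, Complex.conj_I]
      rw [← e1, e2, ← h]
      linear_combination inner ℂ p.1 (J (Γ q.2)) * Complex.I_mul_I
    have key' := hD.map_J _ key
    simp only [hD.J_J, map_smul] at key'
    refine mem_gaugeRel.2 ⟨_, _, key', (hΓ.right_inv hD p.1).symm, ?_⟩
    rw [hΓ.right_inv hD, map_smul, map_smul, hΓ.self_J_adjoint, hD.J_J, smul_smul]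
    simp

/-- The inverse of `Γ` is `J Γ' J` with `J` isometric, so a bound on the adjoint is a bound on the
inverse. -/
theorem exists_bound_of_mem_gaugeRel (hD : IsDiracSystem D J V) (hΓ : IsGauge J Γ Γ') {C : ℝ}
    (hC : ∀ x, ‖Γ' x‖ ≤ C * ‖x‖) {p : H × H} (hp : p ∈ gaugeRel D J V Γ) :
    ∃ φ w, (φ, w) ∈ D ∧ p.1 = Γ φ ∧ p.2 = (-Complex.I) • J (Γ w) + V (Γ φ) ∧
      ‖φ‖ ≤ C * ‖p.1‖ ∧ ‖w‖ ≤ C * ‖p.2 - V p.1‖ := by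
  obtain ⟨φ, w, h, h1, h2⟩ := mem_gaugeRel.1 hp
  have hb : ∀ x, ‖x‖ ≤ C * ‖Γ x‖ := fun x => by
    have := hC (J (Γ x))
    rwa [← hD.norm_J (Γ' _), hΓ.left_inv hD, hD.norm_J] at this
  refine ⟨φ, w, h, h1, h2, h1 ▸ hb φ, (hb w).trans_eq ?_⟩
  rw [h2, h1, add_sub_cancel_right, norm_smul, hD.norm_J]
  simp

/-- The resolvents of two gauge transforms are close when the gauges are close as maps from the
domain of the derivative. -/
theorem norm_resolvent_sub_le [CompleteSpace H] (hD : IsDiracSystem D J V) (hΓ : IsGauge J Γ Γ')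
    (hΓ₀ : IsGauge J Γ₀ Γ₀') {C δ : ℝ} (hC0 : 0 ≤ C) (hδ : 0 ≤ δ)
    (hC : ∀ x, ‖Γ x‖ ≤ C * ‖x‖) (hC' : ∀ x, ‖Γ' x‖ ≤ C * ‖x‖)
    (hC₀ : ∀ x, ‖Γ₀ x‖ ≤ C * ‖x‖) (hC₀' : ∀ x, ‖Γ₀' x‖ ≤ C * ‖x‖)
    (hsub : ∀ φ w, (φ, w) ∈ D → ‖Γ φ - Γ₀ φ‖ ≤ δ * (‖φ‖ + ‖w‖)) {R R₀ : H →L[ℂ] H}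
    (hR : IsRelResolventAt (gaugeRel D J V Γ) (-Complex.I) R)
    (hR₀ : IsRelResolventAt (gaugeRel D J V Γ₀) (-Complex.I) R₀) :
    ‖R - R₀‖ ≤ 4 * C * (C * (1 + ‖V‖)) ^ 2 * δ := by
  have hT := isSelfAdjointRel_gaugeRel hD hΓ
  have hT₀ := isSelfAdjointRel_gaugeRel hD hΓ₀
  -- The resolvent at the conjugate point `i` plays the role of the adjoint of `R`.
  obtain ⟨R', hR'⟩ := hT.exists_resolvent (z := Complex.I) (by simp) (by simp)
  set B := C * (1 + ‖V‖) with hB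
  have hB0 : 0 ≤ B := by positivity
  have hbd : ∀ {p : H × H} {a φ w : H}, ‖p.1‖ ≤ ‖a‖ → ‖p.2‖ ≤ ‖a‖ → ‖φ‖ ≤ C * ‖p.1‖ →
      ‖w‖ ≤ C * ‖p.2 - V p.1‖ → ‖φ‖ ≤ B * ‖a‖ ∧ ‖w‖ ≤ B * ‖a‖ := by
    intro p a φ w h1 h2 h3 h4
    have h5 : ‖p.2 - V p.1‖ ≤ ‖a‖ + ‖V‖ * ‖a‖ :=
      (norm_sub_le _ _).trans (add_le_add h2 ((V.le_opNorm _).trans (by gcongr)))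
    constructor
    · refine h3.trans ?_
      rw [hB, mul_assoc]
      gcongr
      nlinarith [norm_nonneg V, norm_nonneg a]
    · refine h4.trans ?_
      rw [hB, mul_assoc]
      gcongr
      linarith
  have key : ∀ f g : H, ‖inner ℂ g ((R - R₀) f)‖ ≤ 4 * C * B ^ 2 * δ * ‖f‖ * ‖g‖ := by
    intro f g
    have hv := hR'.mem g
    have hu := hR₀.mem f
    have huε := hR.mem f
    have nv := hT.norm_le (z := Complex.I) (by simp) (by simp) hv
    have nu := hT₀.norm_le (z := -Complex.I) (by simp) (by simp) hu
    simp only [add_sub_cancel_right] at nv nu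
    have hs := hT.symm _ hv _ huε
    obtain ⟨χ, wχ, hχ, ev, eG, bχ, bwχ⟩ := exists_bound_of_mem_gaugeRel hD hΓ hC' hv
    obtain ⟨φ, wφ, hφ, eu, eF, bφ, bwφ⟩ := exists_bound_of_mem_gaugeRel hD hΓ₀ hC₀' hu
    obtain ⟨bχ, bwχ⟩ := hbd nv.1 nv.2 bχ bwχ
    obtain ⟨bφ, bwφ⟩ := hbd nu.1 nu.2 bφ bwφ
    -- The right side is the form `⟨R' g, T₀ R₀ f⟩ - ⟨T R' g, R₀ f⟩`, with `T` and `T₀` the two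
    -- gauged operators; `hs` turns `⟨R' g, f⟩` into `⟨g, R f⟩`.
    have e1 : inner ℂ g ((R - R₀) f) =
        inner ℂ (R' g) (f + (-Complex.I) • R₀ f) - inner ℂ (g + Complex.I • R' g) (R₀ f) := by
      simp only [inner_add_left, inner_add_right, inner_smul_left, inner_smul_right,
        Complex.conj_I, sub_apply, inner_sub_right] at hs ⊢
      linear_combination -hs
    simp only at ev eG eu eF
    have hmain := hD.skew _ (hD.map_J _ hχ) _ hφ
    simp only at hmain
    -- The `V` terms cancel by symmetry. Replacing `Γ` by `Γ₀` on `χ` and `Γ₀` by `Γ` on `φ` leaves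
    -- the two displayed errors and `⟨J χ, wφ⟩ + ⟨J wχ, φ⟩`, which is zero by skewness of `D`.
    have e2 : inner ℂ g ((R - R₀) f) =
        (-Complex.I) * (inner ℂ (Γ χ - Γ₀ χ) (J (Γ₀ wφ)) - inner ℂ (Γ wχ) (J (Γ φ - Γ₀ φ))) := by
      have a1 : ∀ x y, inner ℂ (Γ₀ x) (J (Γ₀ y)) = inner ℂ (J x) y := fun x y => by
        rw [hΓ₀.inner_eq, hΓ₀.adjoint_J_self, hD.inner_J]
      have a2 : ∀ x y, inner ℂ (Γ x) (J (Γ y)) = inner ℂ (J x) y := fun x y => by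
        rw [hΓ.inner_eq, hΓ.adjoint_J_self, hD.inner_J]
      rw [e1, eF, eG, eu, ev]
      simp only [inner_add_left, inner_add_right, inner_smul_left, inner_smul_right,
        inner_sub_left, inner_sub_right, map_sub, map_neg, Complex.conj_I, hD.inner_V,
        hD.inner_J (Γ wχ), a1, a2]
      linear_combination (-Complex.I) * hmain
    -- The factor 2 comes from `‖χ‖ + ‖wχ‖ ≤ 2 B ‖g‖`; with `n2` it makes the constant 4 of the
    -- statement.
    have n1 : ‖inner ℂ (Γ χ - Γ₀ χ) (J (Γ₀ wφ))‖ ≤ 2 * C * B ^ 2 * δ * ‖f‖ * ‖g‖ := by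
      refine (norm_inner_le_norm _ _).trans ?_
      rw [hD.norm_J]
      calc ‖Γ χ - Γ₀ χ‖ * ‖Γ₀ wφ‖ ≤ (δ * (B * ‖g‖ + B * ‖g‖)) * (C * (B * ‖f‖)) := by
            gcongr
            · exact (hsub _ _ hχ).trans (by gcongr)
            · exact (hC₀ _).trans (by gcongr)
        _ = _ := by ring
    have n2 : ‖inner ℂ (Γ wχ) (J (Γ φ - Γ₀ φ))‖ ≤ 2 * C * B ^ 2 * δ * ‖f‖ * ‖g‖ := by
      refine (norm_inner_le_norm _ _).trans ?_
      rw [hD.norm_J]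
      calc ‖Γ wχ‖ * ‖Γ φ - Γ₀ φ‖ ≤ (C * (B * ‖g‖)) * (δ * (B * ‖f‖ + B * ‖f‖)) := by
            gcongr
            · exact (hC _).trans (by gcongr)
            · exact (hsub _ _ hφ).trans (by gcongr)
        _ = _ := by ring
    rw [e2, norm_mul, norm_neg, Complex.norm_I, one_mul]
    refine (norm_sub_le _ _).trans ?_
    linarith
  refine ContinuousLinearMap.opNorm_le_bound _ (by positivity) fun f => ?_
  have h := key f ((R - R₀) f)
  rw [inner_self_eq_norm_sq_to_K, norm_pow, RCLike.norm_ofReal, abs_norm, pow_two] at h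
  rcases (norm_nonneg ((R - R₀) f)).eq_or_lt with h0 | h0
  · rw [← h0]; positivity
  · exact le_of_mul_le_mul_right h h0

end Gauge

/-! ### The exponential gauge factors. -/

section GaugeMap

variable {𝔸 : Type*} [NormedRing 𝔸] [NormedAlgebra ℂ 𝔸]

/-- The one-parameter group generated by `T`. -/
def gaugeMap (T : 𝔸) (t : ℝ) : 𝔸 := NormedSpace.exp ((t : ℂ) • T)

theorem gaugeMap_zero (T : 𝔸) : gaugeMap T 0 = 1 := by
  rw [gaugeMap, Complex.ofReal_zero, zero_smul, NormedSpace.exp_zero]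

theorem gaugeMap_one (T : 𝔸) : gaugeMap T 1 = NormedSpace.exp T := by
  rw [gaugeMap, Complex.ofReal_one, one_smul]

variable [CompleteSpace 𝔸]

theorem gaugeMap_neg_mul (T : 𝔸) (t : ℝ) : gaugeMap (-T) t * gaugeMap T t = 1 := by
  let : NormedAlgebra ℚ 𝔸 := NormedAlgebra.restrictScalars ℚ ℂ 𝔸
  rw [gaugeMap, gaugeMap, smul_neg,
    ← NormedSpace.exp_add_of_commute ((Commute.refl ((t : ℂ) • T)).neg_left), neg_add_cancel,
    NormedSpace.exp_zero]

theorem gaugeMap_mul_neg (T : 𝔸) (t : ℝ) : gaugeMap T t * gaugeMap (-T) t = 1 := by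
  simpa using gaugeMap_neg_mul (-T) t

theorem hasDerivAt_gaugeMap (T : 𝔸) (t : ℝ) :
    HasDerivAt (gaugeMap T) (T * gaugeMap T t) t := by
  have h := (hasDerivAt_exp_smul_const' T (t : ℂ)).scomp t Complex.ofRealCLM.hasDerivAt
  rw [Complex.ofRealCLM_apply, Complex.ofReal_one, one_smul] at h
  exact h

theorem continuous_gaugeMap (T : 𝔸) : Continuous (gaugeMap T) :=
  continuous_iff_continuousAt.2 fun t => (hasDerivAt_gaugeMap T t).continuousAt

/-- Compactness bounds the group on `[-B, B]`, and the mean value inequality gives a Lipschitz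
bound; a single constant serves for both. -/
theorem exists_gaugeMap_bound (T : 𝔸) (B : ℝ) : ∃ C, 0 ≤ C ∧
    (∀ t, |t| ≤ B → ‖gaugeMap T t‖ ≤ C) ∧
    ∀ s t, |s| ≤ B → |t| ≤ B → ‖gaugeMap T s - gaugeMap T t‖ ≤ C * |s - t| := by
  obtain ⟨c, hc⟩ := (isCompact_Icc (a := -B) (b := B)).exists_bound_of_continuousOn
    (continuous_gaugeMap T).continuousOn
  have hc' : ∀ t, |t| ≤ B → ‖gaugeMap T t‖ ≤ |c| := fun t ht =>
    (hc t (abs_le.1 ht)).trans (le_abs_self c)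
  refine ⟨(1 + ‖T‖) * |c|, by positivity, fun t ht => (hc' t ht).trans ?_, fun s t hs ht => ?_⟩
  · nlinarith [norm_nonneg T, abs_nonneg c]
  · have h := Convex.norm_image_sub_le_of_norm_hasDerivWithin_le (f := gaugeMap T)
      (s := Set.Icc (-B) B) (x := t) (y := s) (C := ‖T‖ * |c|)
      (fun x _ => (hasDerivAt_gaugeMap T x).hasDerivWithinAt)
      (fun x hx => (norm_mul_le _ _).trans (by gcongr; exact hc' x (abs_le.2 hx)))
      (convex_Icc _ _) (abs_le.1 ht) (abs_le.1 hs)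
    refine h.trans ?_
    rw [Real.norm_eq_abs]
    gcongr
    linarith [norm_nonneg T]

variable [StarRing 𝔸] [StarModule ℂ 𝔸] [ContinuousStar 𝔸] {T J : 𝔸}

/-- The hypothesis reads `star T = J (-T) J⁻¹`, and the exponential commutes with conjugation by a
unit. -/
theorem star_gaugeMap_mul (hJ : J * J = 1) (hT : star T * J = -(J * T)) (t : ℝ) :
    star (gaugeMap T t) * J = J * gaugeMap (-T) t := by
  let : NormedAlgebra ℚ 𝔸 := NormedAlgebra.restrictScalars ℚ ℂ 𝔸
  let U : 𝔸ˣ := ⟨J, J, hJ, hJ⟩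
  have h1 : star T = J * (-T) * J := by
    rw [mul_neg, ← hT, mul_assoc, hJ, mul_one]
  have h2 : (t : ℂ) • star T = U * ((t : ℂ) • (-T)) * (U⁻¹ : 𝔸ˣ) := by
    change (t : ℂ) • star T = J * ((t : ℂ) • (-T)) * J
    rw [h1, mul_smul_comm, smul_mul_assoc]
  have h3 : star (gaugeMap T t) = NormedSpace.exp ((t : ℂ) • star T) := by
    rw [gaugeMap, NormedSpace.star_exp, star_smul]
    simp
  rw [h3, h2, NormedSpace.exp_units_conj]
  change J * NormedSpace.exp ((t : ℂ) • -T) * J * J = _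
  rw [mul_assoc, hJ, mul_one, gaugeMap]

theorem star_gaugeMap_mul_mul (hJ : J * J = 1) (hT : star T * J = -(J * T)) (t : ℝ) :
    star (gaugeMap T t) * J * gaugeMap T t = J := by
  rw [star_gaugeMap_mul hJ hT, mul_assoc, gaugeMap_neg_mul, mul_one]

theorem gaugeMap_mul_mul_star (hJ : J * J = 1) (hT : star T * J = -(J * T)) (t : ℝ) :
    gaugeMap T t * J * star (gaugeMap T t) = J := by
  have h1 : J * star (gaugeMap T t) = gaugeMap (-T) t * J := by
    calc J * star (gaugeMap T t) = J * (star (gaugeMap T t) * J) * J := by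
          rw [mul_assoc, mul_assoc, hJ, mul_one]
      _ = gaugeMap (-T) t * J := by rw [star_gaugeMap_mul hJ hT, ← mul_assoc, hJ, one_mul]
  rw [mul_assoc, h1, ← mul_assoc, gaugeMap_mul_neg, one_mul]

end GaugeMap

theorem gaugeMap_neg_apply (T : Spinor →L[ℂ] Spinor) (t : ℝ) (v : Spinor) :
    gaugeMap (-T) t (gaugeMap T t v) = v :=
  congrArg (fun S : Spinor →L[ℂ] Spinor => S v) (gaugeMap_neg_mul T t)

theorem gaugeMap_apply_neg (T : Spinor →L[ℂ] Spinor) (t : ℝ) (v : Spinor) :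
    gaugeMap T t (gaugeMap (-T) t v) = v :=
  congrArg (fun S : Spinor →L[ℂ] Spinor => S v) (gaugeMap_mul_neg T t)

/-! ### Multiplication operators on `L²`. -/

section MulOp

/-- Multiplication by a bounded operator-valued function on `L²`. -/
def mulOp (G : ℝ → Spinor →L[ℂ] Spinor) (hG : MemLp G ∞ volume) : L2 →L[ℂ] L2 :=
  (ContinuousLinearMap.id ℂ (Spinor →L[ℂ] Spinor)).holderL volume ∞ 2 2 (hG.toLp G)

theorem coeFn_mulOp {G : ℝ → Spinor →L[ℂ] Spinor} (hG : MemLp G ∞ volume) (f : L2) :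
    mulOp G hG f =ᵐ[volume] fun x => G x (f x) := by
  have h := (ContinuousLinearMap.id ℂ (Spinor →L[ℂ] Spinor)).coeFn_holder (r := 2) (hG.toLp G) f
  filter_upwards [h, hG.coeFn_toLp] with x h1 h2
  refine h1.trans ?_
  rw [h2]
  rfl

theorem coeFn_matOp (B : Matrix (Fin 2) (Fin 2) ℂ) (f : L2) :
    matOp B f =ᵐ[volume] fun x => Matrix.toEuclideanCLM (𝕜 := ℂ) (n := Fin 2) B (f x) :=
  ContinuousLinearMap.coeFn_compLpL _ _

theorem coeFn_potential {w : ℝ → ℝ} (hw : MemLp w ∞ volume) (B : Matrix (Fin 2) (Fin 2) ℂ)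
    (f : L2) : potential w hw B f =ᵐ[volume]
      fun x => w x • Matrix.toEuclideanCLM (𝕜 := ℂ) (n := Fin 2) B (f x) := by
  have h := (ContinuousLinearMap.lsmul ℂ ℂ : ℂ →L[ℂ] Spinor →L[ℂ] Spinor).coeFn_holder (r := 2)
    (MemLp.toLp (fun x => (w x : ℂ)) hw.ofReal) (matOp B f)
  filter_upwards [h, (hw.ofReal (K := ℂ)).coeFn_toLp, coeFn_matOp B f] with x h1 h2 h3
  refine h1.trans ?_
  rw [h3]
  erw [h2]
  exact Complex.coe_smul _ _

theorem norm_mulOp_le {G : ℝ → Spinor →L[ℂ] Spinor} (hG : MemLp G ∞ volume) {C : ℝ}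
    (hC : ∀ᵐ x, ‖G x‖ ≤ C) (f : L2) : ‖mulOp G hG f‖ ≤ C * ‖f‖ := by
  refine Lp.norm_le_mul_norm_of_ae_le_mul ?_
  filter_upwards [coeFn_mulOp hG f, hC] with x h1 h2
  rw [h1]
  exact ((G x).le_opNorm _).trans (by gcongr)

theorem isGauge_mulOp {J G G' : ℝ → Spinor →L[ℂ] Spinor} (hJ : MemLp J ∞ volume)
    (hG : MemLp G ∞ volume) (hG' : MemLp G' ∞ volume) (hadj : ∀ x, star (G x) = G' x)
    (h1 : ∀ x, G' x * J x * G x = J x) (h2 : ∀ x, G x * J x * G' x = J x) :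
    IsGauge (mulOp J hJ) (mulOp G hG) (mulOp G' hG') := by
  refine ⟨fun f g => ?_, fun f => Lp.ext ?_, fun f => Lp.ext ?_⟩
  · rw [L2.inner_def, L2.inner_def]
    refine integral_congr_ae ?_
    filter_upwards [coeFn_mulOp hG f, coeFn_mulOp hG' g] with x a b
    rw [a, b, ← hadj, ContinuousLinearMap.star_eq_adjoint,
      ContinuousLinearMap.adjoint_inner_right]
  · filter_upwards [coeFn_mulOp hG f, coeFn_mulOp hJ (mulOp G hG f),
      coeFn_mulOp hG' (mulOp J hJ (mulOp G hG f)), coeFn_mulOp hJ f] with x a b c d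
    rw [c, b, a, d]
    exact congrArg (fun S : Spinor →L[ℂ] Spinor => S (f x)) (h1 x)
  · filter_upwards [coeFn_mulOp hG' f, coeFn_mulOp hJ (mulOp G' hG' f),
      coeFn_mulOp hG (mulOp J hJ (mulOp G' hG' f)), coeFn_mulOp hJ f] with x a b c d
    rw [c, b, a, d]
    exact congrArg (fun S : Spinor →L[ℂ] Spinor => S (f x)) (h2 x)

end MulOp

/-! ### Weak derivatives near the origin. -/

section Singularity

/-- Dominated convergence: the bumps shrink to the origin, which is a null set. -/
theorem tendsto_integral_bump_smul (b : ContDiffBump (0 : ℝ)) {q : ℝ → Spinor}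
    (hq : Integrable q) :
    Tendsto (fun n : ℕ => ∫ x, b (((n : ℝ) + 1) * x) • q x) atTop (𝓝 0) := by
  rw [← integral_zero ℝ Spinor (μ := volume)]
  refine tendsto_integral_of_dominated_convergence (fun x => ‖q x‖) (fun n => ?_) hq.norm
    (fun n => ?_) ?_
  · exact (b.continuous.comp (by fun_prop)).aestronglyMeasurable.smul hq.aestronglyMeasurable
  · refine Eventually.of_forall fun x => ?_
    rw [norm_smul, Real.norm_of_nonneg b.nonneg]
    exact mul_le_of_le_one_left (norm_nonneg _) b.le_one
  · have h0 : ∀ᵐ x : ℝ, x ≠ 0 := by simp [ae_iff]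
    filter_upwards [h0] with x hx
    refine tendsto_const_nhds.congr' ?_
    have ht : Tendsto (fun n : ℕ => ((n : ℝ) + 1) * |x|) atTop atTop :=
      (tendsto_atTop_add_const_right _ _ tendsto_natCast_atTop_atTop).atTop_mul_const
        (abs_pos.2 hx)
    filter_upwards [ht.eventually_ge_atTop b.rOut] with n hn
    rw [b.zero_of_le_dist, zero_smul]
    rw [dist_zero_right, Real.norm_eq_abs, abs_mul, abs_of_pos (by positivity)]
    exact hn

/-- A point singularity of a weak derivative is removable if the function vanishes there. -/
theorem HasWeakDerivOn.univ_of_tendsto_zero {u w c : ℝ → Spinor} (h : HasWeakDerivOn {0}ᶜ u w)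
    (hu : LocallyIntegrable u) (hw : LocallyIntegrable w) (hcu : c =ᵐ[volume] u)
    (hc : Tendsto c (𝓝[≠] 0) (𝓝 0)) : HasWeakDerivOn Set.univ u w := by
  intro φ hφ hφc _
  let b : ContDiffBump (0 : ℝ) := ⟨1, 2, by norm_num, by norm_num⟩
  have hd : Continuous (deriv φ) := hφ.continuous_deriv (by simp)
  have hdb : Continuous (deriv b) := (b.contDiff (n := 1)).continuous_deriv (by simp)
  let η : ℕ → ℝ → ℝ := fun n x => b (((n : ℝ) + 1) * x)
  have hη : ∀ n, ContDiff ℝ ∞ (η n) := fun n => b.contDiff.comp (contDiff_const.mul contDiff_id)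
  have hηd : ∀ n x, HasDerivAt (η n) (((n : ℝ) + 1) * deriv b (((n : ℝ) + 1) * x)) x := by
    intro n x
    have h1 : HasDerivAt (fun x : ℝ => ((n : ℝ) + 1) * x) ((n : ℝ) + 1) x := by
      simpa using (hasDerivAt_id x).const_mul ((n : ℝ) + 1)
    have h2 : HasDerivAt b (deriv b (((n : ℝ) + 1) * x)) (((n : ℝ) + 1) * x) :=
      ((b.contDiff (n := 1)).differentiable (by simp)).differentiableAt.hasDerivAt
    rw [mul_comm]
    exact h2.comp x h1
  let r : ℕ → ℝ → ℝ := fun n x => φ x * (((n : ℝ) + 1) * deriv b (((n : ℝ) + 1) * x))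
  have hr : ∀ n, Continuous (r n) := fun n => by
    have := hφ.continuous
    fun_prop
  have hrc : ∀ n, HasCompactSupport (r n) := fun n => hφc.mul_right
  have hi : ∀ {ψ : ℝ → ℝ}, Continuous ψ → HasCompactSupport ψ → ∀ {g : ℝ → Spinor},
      LocallyIntegrable g → Integrable fun x => ψ x • g x := fun hψ hc _ hg =>
    hg.integrable_smul_left_of_hasCompactSupport hψ hc
  -- The function `(1 - η n) φ` vanishes near the origin, so it is an admissible test function. The
  -- term `r n = φ (η n)'` is the only one that does not tend to zero merely by shrinking supports.
  have hid : ∀ n, (∫ x, deriv φ x • u x) + (∫ x, φ x • w x) =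
      ((∫ x, η n x • deriv φ x • u x) + (∫ x, η n x • φ x • w x)) + ∫ x, r n x • u x := by
    intro n
    have hderiv : deriv (fun x => φ x - η n x * φ x) =
        fun x => deriv φ x - η n x * deriv φ x - r n x := by
      funext x
      have hφx : HasDerivAt φ (deriv φ x) x :=
        (hφ.differentiable (by simp)).differentiableAt.hasDerivAt
      rw [(hφx.fun_sub ((hηd n x).fun_mul hφx)).deriv]
      simp only [r]
      ring
    have key := h (fun x => φ x - η n x * φ x) (hφ.sub ((hη n).mul hφ)) (hφc.sub hφc.mul_left) (by
      intro x hx hx0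
      rw [Set.mem_singleton_iff] at hx0
      subst hx0
      rw [← not_not (a := (0 : ℝ) ∈ _), notMem_tsupport_iff_eventuallyEq] at hx
      refine hx ?_
      have hcont : Tendsto (fun x : ℝ => ((n : ℝ) + 1) * x) (𝓝 0) (𝓝 0) := by
        have : Continuous fun x : ℝ => ((n : ℝ) + 1) * x := by fun_prop
        simpa using this.tendsto 0
      filter_upwards [hcont.eventually b.eventuallyEq_one] with x hx
      have : η n x = 1 := hx
      simp [this])
    have i1 := hi hd hφc.deriv hu
    have i2 : Integrable fun x => η n x • deriv φ x • u x := by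
      simpa only [Pi.mul_apply, mul_smul] using hi ((hη n).continuous.mul hd) hφc.deriv.mul_left hu
    have i3 := hi (hr n) (hrc n) hu
    have i4 := hi hφ.continuous hφc hw
    have i5 : Integrable fun x => η n x • φ x • w x := by
      simpa only [Pi.mul_apply, mul_smul] using
        hi ((hη n).continuous.mul hφ.continuous) hφc.mul_left hw
    rw [hderiv] at key
    simp only [sub_smul, mul_smul] at key
    have i12 : Integrable fun x => deriv φ x • u x - η n x • deriv φ x • u x := i1.sub i2
    rw [integral_sub i12 i3, integral_sub i1 i2, integral_sub i4 i5] at key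
    rw [sub_eq_iff_eq_add.1 (sub_eq_iff_eq_add.1 key)]
    abel
  obtain ⟨Cφ, hCφ⟩ := hφc.exists_bound_of_continuous hφ.continuous
  obtain ⟨Cb, hCb⟩ := b.hasCompactSupport.deriv.exists_bound_of_continuous hdb
  have hCφ0 : 0 ≤ Cφ := (norm_nonneg _).trans (hCφ 0)
  have hCb0 : 0 ≤ Cb := (norm_nonneg _).trans (hCb 0)
  have hr0 : Tendsto (fun n => ∫ x, r n x • u x) atTop (𝓝 0) := by
    rw [Metric.tendsto_atTop]
    intro ε hε
    -- `r n` is at most `Cφ Cb (n + 1)` and lives on an interval of length `4 / (n + 1)`, so the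
    -- integral is at most `4 Cφ Cb δ`; the added 1 avoids division by zero.
    set δ := ε / (4 * Cφ * Cb + 1) with hδ
    have hδ0 : 0 < δ := by positivity
    have hev : ∀ᶠ x in 𝓝[≠] (0 : ℝ), ‖c x‖ < δ := by
      filter_upwards [hc.eventually (Metric.ball_mem_nhds 0 hδ0)] with x hx
      simpa using hx
    rw [eventually_nhdsWithin_iff, Metric.eventually_nhds_iff] at hev
    obtain ⟨ρ, hρ, hρc⟩ := hev
    obtain ⟨N, hN⟩ := exists_nat_gt (2 / ρ)
    refine ⟨N, fun n hn => ?_⟩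
    have hn1 : (0 : ℝ) < (n : ℝ) + 1 := by positivity
    have hn2 : 2 / ((n : ℝ) + 1) < ρ := by
      rw [div_lt_iff₀ hρ] at hN
      rw [div_lt_iff₀ hn1]
      have : (N : ℝ) ≤ n := by exact_mod_cast hn
      nlinarith
    have hsupp : ∀ x, x ∉ Set.Icc (-(2 / ((n : ℝ) + 1))) (2 / ((n : ℝ) + 1)) →
        r n x • u x = 0 := by
      intro x hx
      have hb0 : deriv b (((n : ℝ) + 1) * x) = 0 := by
        refine image_eq_zero_of_notMem_tsupport fun hmem => hx ?_
        have h1 := tsupport_deriv_subset hmem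
        rw [b.tsupport_eq, Metric.mem_closedBall, dist_zero_right, Real.norm_eq_abs, abs_mul,
          abs_of_pos hn1] at h1
        rw [Set.mem_Icc, ← abs_le, le_div_iff₀ hn1, mul_comm]
        exact h1
      simp [r, hb0]
    rw [dist_zero_right, ← setIntegral_eq_integral_of_forall_compl_eq_zero hsupp]
    have h0 : ∀ᵐ x : ℝ, x ≠ 0 := by simp [ae_iff]
    have hbd := norm_setIntegral_le_of_norm_le_const_ae (μ := volume)
      (s := Set.Icc (-(2 / ((n : ℝ) + 1))) (2 / ((n : ℝ) + 1))) (f := fun x => r n x • u x)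
      (C := Cφ * (((n : ℝ) + 1) * Cb) * δ) (by simp) (by
        filter_upwards [ae_restrict_mem measurableSet_Icc, ae_restrict_of_ae h0,
          ae_restrict_of_ae hcu] with x hx hx0 hxc
        have hcx : ‖u x‖ ≤ δ := by
          rw [← hxc]
          refine (hρc ?_ hx0).le
          rw [dist_zero_right, Real.norm_eq_abs]
          exact (abs_le.2 hx).trans_lt hn2
        rw [norm_smul]
        simp only [r, norm_mul, Real.norm_of_nonneg hn1.le]
        gcongr
        · exact hCφ x
        · exact hCb _)
    refine hbd.trans_lt ?_
    rw [Measure.real, Real.volume_Icc, ENNReal.toReal_ofReal (by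
      have : 0 < 2 / ((n : ℝ) + 1) := by positivity
      linarith)]
    have e : Cφ * (((n : ℝ) + 1) * Cb) * δ * (2 / ((n : ℝ) + 1) - -(2 / ((n : ℝ) + 1))) =
        4 * Cφ * Cb * δ := by
      field_simp
      ring
    rw [e, hδ, ← mul_div_assoc, div_lt_iff₀ (by positivity)]
    nlinarith
  have hlim := ((tendsto_integral_bump_smul b (hi hd hφc.deriv hu)).add
    (tendsto_integral_bump_smul b (hi hφ.continuous hφc hw))).add hr0
  have hz := tendsto_nhds_unique (hlim.congr fun n => (hid n).symm) tendsto_const_nhds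
  simp only [add_zero] at hz
  exact eq_neg_of_add_eq_zero_left hz.symm

/-- A point singularity of a weak derivative is removable if the function is continuous there. -/
theorem HasWeakDerivOn.univ_of_tendsto {u w c : ℝ → Spinor} (h : HasWeakDerivOn {0}ᶜ u w)
    (hu : LocallyIntegrable u) (hw : LocallyIntegrable w) (hcu : c =ᵐ[volume] u) {m : Spinor}
    (hc : Tendsto c (𝓝[≠] 0) (𝓝 m)) : HasWeakDerivOn Set.univ u w := by
  have hm : LocallyIntegrable fun _ : ℝ => m := continuous_const.locallyIntegrable
  have hp : IsPrimitive (fun _ => m) (fun _ => 0) := ⟨locallyIntegrable_zero, fun a b => by simp⟩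
  have aux : ∀ φ : ℝ → ℝ, ContDiff ℝ ∞ φ → HasCompactSupport φ →
      ∫ x, deriv φ x • (u x - m) = ∫ x, deriv φ x • u x := by
    intro φ hφ hφc
    have hd : Continuous (deriv φ) := hφ.continuous_deriv (by simp)
    have h0 := hp.hasWeakDerivOn Set.univ φ hφ hφc (Set.subset_univ _)
    simp only [smul_zero, integral_zero, neg_zero] at h0
    simp only [smul_sub]
    rw [integral_sub (hu.integrable_smul_left_of_hasCompactSupport hd hφc.deriv)
      (hm.integrable_smul_left_of_hasCompactSupport hd hφc.deriv), h0, sub_zero]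
  have h' : HasWeakDerivOn {0}ᶜ (fun x => u x - m) w := fun φ hφ hφc hs => by
    rw [aux φ hφ hφc, h φ hφ hφc hs]
  have key := h'.univ_of_tendsto_zero (hu.sub hm) hw
    (hcu.mono fun x hx => congrArg (· - m) hx) (by simpa using hc.sub_const m)
  intro φ hφ hφc hs
  rw [← aux φ hφ hφc, key φ hφ hφc hs]

/-- The test function is zero near the origin, so cutting it off there creates no singularity. -/
theorem contDiff_indicator_Ioi {φ : ℝ → ℝ} (hφ : ContDiff ℝ ∞ φ)
    (hs : tsupport φ ⊆ {0}ᶜ) : ContDiff ℝ ∞ ((Set.Ioi 0).indicator φ) ∧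
      deriv ((Set.Ioi 0).indicator φ) = (Set.Ioi 0).indicator (deriv φ) := by
  have hloc : ∀ x : ℝ, ((Set.Ioi 0).indicator φ =ᶠ[𝓝 x] φ ∧
      (Set.Ioi 0).indicator (deriv φ) x = deriv φ x) ∨
      ((Set.Ioi 0).indicator φ =ᶠ[𝓝 x] 0 ∧ (Set.Ioi 0).indicator (deriv φ) x = 0) := by
    intro x
    rcases lt_trichotomy x 0 with hx | rfl | hx
    · right
      refine ⟨?_, Set.indicator_of_notMem (by simpa using hx.le) _⟩
      filter_upwards [Iio_mem_nhds hx] with y hy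
      exact Set.indicator_of_notMem (by simpa using le_of_lt hy) _
    · right
      refine ⟨?_, Set.indicator_of_notMem (by simp) _⟩
      have h0 : (0 : ℝ) ∉ tsupport φ := fun h => hs h rfl
      filter_upwards [notMem_tsupport_iff_eventuallyEq.1 h0] with y hy
      rw [Set.indicator_apply, hy]
      simp
    · left
      refine ⟨?_, Set.indicator_of_mem hx _⟩
      filter_upwards [Ioi_mem_nhds hx] with y hy
      exact Set.indicator_of_mem hy _
  constructor
  · rw [contDiff_iff_contDiffAt]
    intro x
    rcases hloc x with h | h
    · exact hφ.contDiffAt.congr_of_eventuallyEq h.1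
    · exact contDiffAt_const.congr_of_eventuallyEq h.1
  · funext x
    rcases hloc x with h | h
    · rw [h.1.deriv_eq, h.2]
    · rw [h.1.deriv_eq, h.2]
      exact deriv_const x 0

/-- Transforming the values by different maps on the two half-lines preserves weak
differentiability away from the origin. -/
theorem HasWeakDerivOn.ite_pos {u w : ℝ → Spinor} (h : HasWeakDerivOn {0}ᶜ u w)
    (hu : LocallyIntegrable u) (hw : LocallyIntegrable w) (K L : Spinor →L[ℂ] Spinor) :
    HasWeakDerivOn {0}ᶜ (fun x => if 0 < x then K (u x) else L (u x))
      (fun x => if 0 < x then K (w x) else L (w x)) := by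
  intro φ hφ hφc hs
  obtain ⟨hp, hpd⟩ := contDiff_indicator_Ioi hφ hs
  have hsub : Function.support ((Set.Ioi 0).indicator φ) ⊆ Function.support φ := by
    rw [Set.support_indicator]
    exact Set.inter_subset_right
  have hpc : HasCompactSupport ((Set.Ioi 0).indicator φ) := hφc.mono hsub
  have hps : tsupport ((Set.Ioi 0).indicator φ) ⊆ {0}ᶜ := (closure_mono hsub).trans hs
  -- Split the test function into its parts on the two half-lines; both are test functions away from
  -- the origin, and `K` or `L` comes out of the respective integral.
  have key : ∀ {ψ ψ' : ℝ → ℝ} {g : ℝ → Spinor}, Continuous ψ → HasCompactSupport ψ →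
      Continuous ψ' → HasCompactSupport ψ' → (ψ' = (Set.Ioi 0).indicator ψ) →
      LocallyIntegrable g → ∫ x, ψ x • (if 0 < x then K (g x) else L (g x)) =
        K (∫ x, ψ' x • g x) + (L (∫ x, ψ x • g x) - L (∫ x, ψ' x • g x)) := by
    intro ψ ψ' g hψ hψc hψ' hψc' he hg
    have i1 := hg.integrable_smul_left_of_hasCompactSupport hψ hψc
    have i2 := hg.integrable_smul_left_of_hasCompactSupport hψ' hψc'
    have i12 : Integrable fun x => L (ψ x • g x) - L (ψ' x • g x) :=
      (L.integrable_comp i1).sub (L.integrable_comp i2)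
    rw [← K.integral_comp_comm i2, ← L.integral_comp_comm i1, ← L.integral_comp_comm i2,
      ← integral_sub (L.integrable_comp i1) (L.integrable_comp i2),
      ← integral_add (K.integrable_comp i2) i12]
    refine integral_congr_ae (Eventually.of_forall fun x => ?_)
    simp only [← Complex.coe_smul, map_smul, he, Set.indicator_apply, Set.mem_Ioi]
    by_cases hx : 0 < x <;> simp [hx]
  have hd : Continuous (deriv φ) := hφ.continuous_deriv (by simp)
  have hd' : Continuous (deriv ((Set.Ioi 0).indicator φ)) := hp.continuous_deriv (by simp)
  rw [key hd hφc.deriv hd' hpc.deriv hpd hu,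
    key hφ.continuous hφc hp.continuous hpc rfl hw, h φ hφ hφc hs, h _ hp hpc hps]
  simp only [map_neg]
  abel

end Singularity

/-- The operator on spinors given by a matrix. -/
abbrev spinorMap (B : Matrix (Fin 2) (Fin 2) ℂ) : Spinor →L[ℂ] Spinor :=
  Matrix.toEuclideanCLM (𝕜 := ℂ) (n := Fin 2) B

/-! ### The concrete Dirac system and its gauges. -/

section System

/-- The weak derivative on the line as a linear relation. -/
def derivRel : Submodule ℂ (L2 × L2) where
  carrier := {p | HasWeakDerivOn Set.univ p.1 p.2}
  add_mem' h h' := h.add h'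
  zero_mem' := HasWeakDerivOn.zero _
  smul_mem' c _ h := h.smul c

theorem HasWeakDerivOn.matOp {U : Set ℝ} {u w : L2} (h : HasWeakDerivOn U u w)
    (B : Matrix (Fin 2) (Fin 2) ℂ) : HasWeakDerivOn U (matOp B u) (matOp B w) := by
  intro φ hφ hc hs
  have hd : Continuous (deriv φ) := hφ.continuous_deriv (by simp)
  have key : ∀ {ψ : ℝ → ℝ} (_ : Continuous ψ) (_ : HasCompactSupport ψ) (g : L2),
      ∫ x, ψ x • DiracPoint.matOp B g x = spinorMap B (∫ x, ψ x • g x) := by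
    intro ψ hψ hψc g
    rw [← (spinorMap B).integral_comp_comm (integrable_test_smul hψ hψc g)]
    refine integral_congr_ae ?_
    filter_upwards [coeFn_matOp B g] with x hx
    rw [hx, ← Complex.coe_smul, ← Complex.coe_smul, map_smul]
  rw [key hd hc.deriv, key hφ.continuous hc, h φ hφ hc hs, map_neg]

theorem inner_matOp {B : Matrix (Fin 2) (Fin 2) ℂ} (hB : star B = B) (f g : L2) :
    inner ℂ (matOp B f) g = inner ℂ f (matOp B g) := by
  have hs : star (spinorMap B) = spinorMap B := by rw [← map_star, hB]
  rw [L2.inner_def, L2.inner_def]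
  refine integral_congr_ae ?_
  filter_upwards [coeFn_matOp B f, coeFn_matOp B g] with x a b
  have e : inner ℂ (spinorMap B (f x)) (g x) = inner ℂ (f x) (spinorMap B (g x)) := by
    nth_rewrite 1 [← hs]
    rw [ContinuousLinearMap.star_eq_adjoint, ContinuousLinearMap.adjoint_inner_left]
  rw [a, b]
  exact e

theorem star_sigma1 : star sigma1 = sigma1 := by
  ext i j
  fin_cases i <;> fin_cases j <;> simp [sigma1]

theorem star_sigma3 : star sigma3 = sigma3 := by
  ext i j
  fin_cases i <;> fin_cases j <;> simp [sigma3]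

theorem sigma1_mul_self : sigma1 * sigma1 = 1 := by
  ext i j
  fin_cases i <;> fin_cases j <;> simp [sigma1]

theorem spinorMap_sigma1_mul_self : spinorMap sigma1 * spinorMap sigma1 = 1 := by
  rw [← map_mul, sigma1_mul_self, map_one]

theorem spinorMap_sigma1_apply (v : Spinor) : spinorMap sigma1 (spinorMap sigma1 v) = v :=
  congrArg (fun S : Spinor →L[ℂ] Spinor => S v) spinorMap_sigma1_mul_self

theorem matOp_sigma1_matOp (f : L2) : matOp sigma1 (matOp sigma1 f) = f := by
  refine Lp.ext ?_
  filter_upwards [coeFn_matOp sigma1 f, coeFn_matOp sigma1 (matOp sigma1 f)] with x a b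
  rw [b, a, spinorMap_sigma1_apply]

theorem isDiracSystem (M : ℝ) :
    IsDiracSystem derivRel (matOp sigma1) ((M : ℂ) • matOp sigma3) where
  skew p hp q hq := HasWeakDerivOn.inner_eq_neg hp hq
  maximal p hp := hasWeakDerivOn_univ_of_inner_eq_neg fun u' w' h => hp (u', w') h
  inner_J := inner_matOp star_sigma1
  J_J := matOp_sigma1_matOp
  map_J p hp := HasWeakDerivOn.matOp hp sigma1
  inner_V f g := by
    simp only [smul_apply, inner_smul_left, inner_smul_right,
      inner_matOp star_sigma3, Complex.conj_ofReal]

end System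

section GaugeOp

theorem memLp_gaugeMap (T : Spinor →L[ℂ] Spinor) {s : ℝ → ℝ} (hs : AEStronglyMeasurable s volume)
    {B : ℝ} (hB : ∀ x, |s x| ≤ B) : MemLp (fun x => gaugeMap T (s x)) ∞ volume := by
  obtain ⟨C, _, hC, _⟩ := exists_gaugeMap_bound T B
  exact memLp_top_of_bound ((continuous_gaugeMap T).comp_aestronglyMeasurable hs) C
    (Eventually.of_forall fun x => hC _ (hB x))

variable {A : Matrix (Fin 2) (Fin 2) ℂ} {s : ℝ → ℝ}

theorem isGauge_gaugeMap (hA : star A * sigma1 = -(sigma1 * A))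
    (hG : MemLp (fun x => gaugeMap (spinorMap A) (s x)) ∞ volume)
    (hG' : MemLp (fun x => star (gaugeMap (spinorMap A) (s x))) ∞ volume) :
    IsGauge (matOp sigma1) (mulOp _ hG) (mulOp _ hG') := by
  have hT : star (spinorMap A) * spinorMap sigma1 = -(spinorMap sigma1 * spinorMap A) := by
    rw [← map_star, ← map_mul, ← map_mul, hA, map_neg]
  have hJ : MemLp (fun _ : ℝ => spinorMap sigma1) ∞ volume :=
    memLp_top_of_bound aestronglyMeasurable_const _ (Eventually.of_forall fun _ => le_rfl)
  have he : mulOp _ hJ = matOp sigma1 := by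
    refine ContinuousLinearMap.ext fun f => Lp.ext ?_
    exact (coeFn_mulOp hJ f).trans (coeFn_matOp sigma1 f).symm
  rw [← he]
  exact isGauge_mulOp hJ hG hG' (fun _ => rfl)
    (fun x => star_gaugeMap_mul_mul spinorMap_sigma1_mul_self hT _)
    (fun x => gaugeMap_mul_mul_star spinorMap_sigma1_mul_self hT _)

theorem mulOp_neg_apply (hG : MemLp (fun x => gaugeMap (spinorMap A) (s x)) ∞ volume)
    (hN : MemLp (fun x => gaugeMap (-spinorMap A) (s x)) ∞ volume) (f : L2) :
    mulOp _ hG (mulOp _ hN f) = f := by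
  refine Lp.ext ?_
  filter_upwards [coeFn_mulOp hN f, coeFn_mulOp hG (mulOp _ hN f)] with x a b
  rw [b, a, gaugeMap_apply_neg]

end GaugeOp

/-! ### The gauge for an absolutely continuous phase. -/

section Smooth

theorem isBoundedBilinearMap_clm_apply :
    IsBoundedBilinearMap ℝ fun p : (Spinor →L[ℂ] Spinor) × Spinor => p.1 p.2 where
  add_left _ _ _ := rfl
  smul_left _ _ _ := rfl
  add_right S := map_add S
  smul_right c S v := by rw [← Complex.coe_smul, map_smul, Complex.coe_smul]
  bound := ⟨1, one_pos, fun S v => by simpa using S.le_opNorm v⟩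

theorem gaugeMap_commute (T : Spinor →L[ℂ] Spinor) (t : ℝ) (v : Spinor) :
    T (gaugeMap T t v) = gaugeMap T t (T v) := by
  let : NormedAlgebra ℚ (Spinor →L[ℂ] Spinor) := NormedAlgebra.restrictScalars ℚ ℂ _
  have h : Commute T (gaugeMap T t) := ((Commute.refl T).smul_right (t : ℂ)).exp_right
  exact congrArg (fun S : Spinor →L[ℂ] Spinor => S v) h

/-- The chain rule: the exponential is Lipschitz on the bounded range of `s`, so the composition
stays absolutely continuous. -/
theorem isPrimitive_gaugeMap (T : Spinor →L[ℂ] Spinor) {s k : ℝ → ℝ} (hs : IsPrimitive s k) {B : ℝ}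
    (hB : ∀ x, |s x| ≤ B) :
    IsPrimitive (fun x => gaugeMap T (s x)) (fun x => k x • (T * gaugeMap T (s x))) := by
  obtain ⟨C, hC0, hC, hL⟩ := exists_gaugeMap_bound T B
  have hcont : Continuous fun x => T * gaugeMap T (s x) :=
    continuous_const.mul ((continuous_gaugeMap T).comp hs.continuous)
  refine isPrimitive_of_ae_hasDerivAt ?_ (fun a b => ?_) ?_
  · rw [locallyIntegrable_iff]
    intro K hK
    refine Integrable.mono' ((hs.locallyIntegrable.integrableOn_isCompact hK).norm.mul_const
      (‖T‖ * C)) (hs.locallyIntegrable.aestronglyMeasurable.smul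
        hcont.aestronglyMeasurable).restrict (Eventually.of_forall fun x => ?_)
    rw [norm_smul]
    gcongr
    exact (norm_mul_le _ _).trans (by gcongr; exact hC _ (hB x))
  · refine absolutelyContinuousOnInterval_of_dist_le (K := C)
      (hs.absolutelyContinuousOnInterval a b) (hs.absolutelyContinuousOnInterval a b)
      fun x _ y _ => ?_
    rw [dist_eq_norm, Real.dist_eq]
    refine (hL _ _ (hB x) (hB y)).trans ?_
    gcongr
    linarith [abs_nonneg (s x - s y)]
  · filter_upwards [hs.ae_hasDerivAt] with x hx
    exact (hasDerivAt_gaugeMap T (s x)).scomp x hx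

/-- The product rule for the weak derivative and the gauge factor. -/
theorem HasWeakDerivOn.mulOp_gaugeMap {A : Matrix (Fin 2) (Fin 2) ℂ} {s k : ℝ → ℝ}
    (hs : IsPrimitive s k) {B : ℝ} (hB : ∀ x, |s x| ≤ B) (hk : MemLp k ∞ volume)
    (hG : MemLp (fun x => gaugeMap (spinorMap A) (s x)) ∞ volume) {u w : L2}
    (h : HasWeakDerivOn Set.univ u w) :
    HasWeakDerivOn Set.univ (mulOp _ hG u)
      (mulOp _ hG (potential k hk A u + w) : L2) := by
  obtain ⟨f, hfu, hf⟩ := h.exists_isPrimitive (locallyIntegrable_coe u) (locallyIntegrable_coe w)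
  have hp := (isPrimitive_gaugeMap (spinorMap A) hs hB).bilin isBoundedBilinearMap_clm_apply hf
  refine (hp.hasWeakDerivOn Set.univ).congr ?_ ?_
  · filter_upwards [coeFn_mulOp hG u, hfu] with x a b
    rw [a, ← b]
  · filter_upwards [coeFn_mulOp hG (potential k hk A u + w), hfu,
      Lp.coeFn_add (potential k hk A u) w, coeFn_potential hk A u] with x a b c d
    rw [a, c, Pi.add_apply, d, map_add, add_comm, b]
    congr 1
    change k x • spinorMap A (gaugeMap (spinorMap A) (s x) (u x)) = _
    rw [gaugeMap_commute, ← Complex.coe_smul, ← Complex.coe_smul, map_smul]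

theorem potential_sigma1_mul {k : ℝ → ℝ} (hk : MemLp k ∞ volume) (A : Matrix (Fin 2) (Fin 2) ℂ)
    (u : L2) : potential k hk (Complex.I • (sigma1 * A)) u =
      Complex.I • matOp sigma1 (potential k hk A u) := by
  refine Lp.ext ?_
  filter_upwards [coeFn_potential hk (Complex.I • (sigma1 * A)) u, coeFn_potential hk A u,
    coeFn_matOp sigma1 (potential k hk A u),
    Lp.coeFn_smul Complex.I (matOp sigma1 (potential k hk A u))] with x a b c d
  rw [a, d, Pi.smul_apply, c, b, map_smul, map_mul, ← Complex.coe_smul, ← Complex.coe_smul,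
    map_smul, smul_comm]
  rfl

end Smooth

/-! ### Graphs of the operators as gauge relations. -/

section Graph

theorem maxDirac_apply (M : ℝ) {ψ g : L2} (hψ : ψ ∈ sobolev {0}ᶜ)
    (h : HasWeakDerivOn {0}ᶜ ψ g) : maxDirac M ⟨ψ, hψ⟩ =
      (-Complex.I) • matOp sigma1 g + (M : ℂ) • matOp sigma3 ψ := by
  have hg : weakDeriv ⟨ψ, hψ⟩ = g := HasWeakDerivOn.unique hψ.choose_spec h
  rw [← hg]
  rfl

theorem mem_graph_freeDirac {M : ℝ} {p : L2 × L2} : p ∈ (freeDirac M).graph ↔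
    ∃ g : L2, HasWeakDerivOn Set.univ p.1 g ∧
      p.2 = (-Complex.I) • matOp sigma1 g + (M : ℂ) • matOp sigma3 p.1 := by
  rw [LinearPMap.mem_graph_iff]
  constructor
  · rintro ⟨⟨ψ, hψ⟩, h1, h2⟩
    obtain ⟨g, hg⟩ := hψ.1
    have h0 := hg.mono (Set.subset_univ {0}ᶜ)
    refine ⟨g, h1 ▸ hg, ?_⟩
    rw [← h2, ← h1, ← maxDirac_apply M hψ.2 h0]
    rfl
  · rintro ⟨g, hg, h2⟩
    have h0 := hg.mono (Set.subset_univ {0}ᶜ)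
    refine ⟨⟨p.1, ⟨g, hg⟩, ⟨g, h0⟩⟩, rfl, ?_⟩
    rw [h2, ← maxDirac_apply M ⟨g, h0⟩ h0]
    rfl

/-- The potential `i h_ε σ₁ A` is `-i σ₁` times `-h_ε A`, so it can be absorbed into the derivative.
-/
theorem mem_graph_approxDirac {M : ℝ} {h : ℝ → ℝ} {hh : MemLp h ∞ volume}
    {A : Matrix (Fin 2) (Fin 2) ℂ} {ε : ℝ} {p : L2 × L2} :
    p ∈ (approxDirac M h hh A ε).graph ↔
    ∃ g : L2, HasWeakDerivOn Set.univ p.1 g ∧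
      p.2 = (-Complex.I) • matOp sigma1 (g - potential (scaled h ε) (memLp_scaled hh ε) A p.1) +
        (M : ℂ) • matOp sigma3 p.1 := by
  have e : ∀ g : L2,
      (-Complex.I) • matOp sigma1 (g - potential (scaled h ε) (memLp_scaled hh ε) A p.1) +
        (M : ℂ) • matOp sigma3 p.1 =
      potential (scaled h ε) (memLp_scaled hh ε) (Complex.I • (sigma1 * A)) p.1 +
        ((-Complex.I) • matOp sigma1 g + (M : ℂ) • matOp sigma3 p.1) := by
    intro g
    rw [potential_sigma1_mul, map_sub, smul_sub, neg_smul, neg_smul]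
    abel
  simp only [e]
  have key := @mem_graph_freeDirac M (p.1, p.2 -
    potential (scaled h ε) (memLp_scaled hh ε) (Complex.I • (sigma1 * A)) p.1)
  simp only [sub_eq_iff_eq_add'] at key
  rw [← key, LinearPMap.mem_graph_iff, LinearPMap.mem_graph_iff]
  constructor
  · rintro ⟨y, h1, h2⟩
    refine ⟨y, h1, ?_⟩
    rw [← h2, ← h1]
    change _ = (_ + freeDirac M y) - _
    exact (add_sub_cancel_left _ _).symm
  · rintro ⟨y, h1, h2⟩
    refine ⟨y, h1, ?_⟩
    have h1' : (y : L2) = p.1 := h1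
    change potential (scaled h ε) (memLp_scaled hh ε) (Complex.I • (sigma1 * A)) y +
      freeDirac M y = _
    rw [h2, h1', add_sub_cancel]

theorem mem_graph_pointDirac {M : ℝ} {Λ : Matrix (Fin 2) (Fin 2) ℂ} {p : L2 × L2} :
    p ∈ (pointDirac M Λ).graph ↔ (∃ m, HasTraces p.1 m (spinorMap Λ m)) ∧
      ∃ g : L2, HasWeakDerivOn {0}ᶜ p.1 g ∧
      p.2 = (-Complex.I) • matOp sigma1 g + (M : ℂ) • matOp sigma3 p.1 := by
  rw [LinearPMap.mem_graph_iff]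
  constructor
  · rintro ⟨⟨ψ, hψ⟩, h1, h2⟩
    obtain ⟨g, hg⟩ := hψ.2
    refine ⟨h1 ▸ hψ.1.2, g, h1 ▸ hg, ?_⟩
    rw [← h2, ← h1, ← maxDirac_apply M hψ.2 hg]
    rfl
  · rintro ⟨hm, g, hg, h2⟩
    refine ⟨⟨p.1, ⟨⟨g, hg⟩, hm⟩, ⟨g, hg⟩⟩, rfl, ?_⟩
    rw [h2, ← maxDirac_apply M ⟨g, hg⟩ hg]
    rfl

theorem IsRelResolventAt.isResolventAt {S : L2 →ₗ.[ℂ] L2} {T : Submodule ℂ (L2 × L2)} {z : ℂ}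
    {R : L2 →L[ℂ] L2} (hR : IsRelResolventAt T z R) (hS : ∀ p, p ∈ S.graph ↔ p ∈ T) :
    IsResolventAt S z R := by
  refine ⟨fun f => ?_, fun ψ => ?_⟩
  · obtain ⟨y, h1, h2⟩ := (LinearPMap.mem_graph_iff S).1 ((hS _).2 (hR.mem f))
    have h1' : (y : L2) = R f := h1
    refine ⟨h1' ▸ y.2, ?_⟩
    have : (⟨R f, h1' ▸ y.2⟩ : S.domain) = y := Subtype.ext h1'.symm
    rw [this, h2, add_sub_cancel_right]
  · exact hR.apply_eq _ ((hS _).1 (LinearPMap.mem_graph S ψ))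

/-- For `ψ = G φ` the product rule gives `ψ' - h_ε A ψ = G φ'`, so the potential disappears in the
variable `φ`. -/
theorem mem_graph_approxDirac_iff (M : ℝ) {h : ℝ → ℝ} (hh : MemLp h ∞ volume)
    (A : Matrix (Fin 2) (Fin 2) ℂ) {ε : ℝ} {s : ℝ → ℝ} (hs : IsPrimitive s (scaled h ε)) {B : ℝ}
    (hB : ∀ x, |s x| ≤ B) (hG : MemLp (fun x => gaugeMap (spinorMap A) (s x)) ∞ volume)
    (p : L2 × L2) : p ∈ (approxDirac M h hh A ε).graph ↔
      p ∈ gaugeRel derivRel (matOp sigma1) ((M : ℂ) • matOp sigma3) (mulOp _ hG) := by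
  set k := scaled h ε
  have hk : MemLp k ∞ volume := memLp_scaled hh ε
  -- The inverse gauge is written with the matrix `-A` so that the product rule for gauges applies
  -- to it verbatim.
  have hN : MemLp (fun x => gaugeMap (spinorMap (-A)) (s x)) ∞ volume :=
    memLp_gaugeMap _ hs.continuous.aestronglyMeasurable hB
  have hcancel : ∀ f, mulOp _ hG (mulOp _ hN f) = f := by
    have e : (fun x => gaugeMap (spinorMap (-A)) (s x)) =
        fun x => gaugeMap (-spinorMap A) (s x) := by
      rw [spinorMap, map_neg]
    intro f
    exact Eq.trans (by congr) (mulOp_neg_apply hG (e ▸ hN) f)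
  have hcomm : ∀ f, mulOp _ hG (potential k hk A f) = potential k hk A (mulOp _ hG f) := by
    intro f
    refine Lp.ext ?_
    filter_upwards [coeFn_mulOp hG (potential k hk A f), coeFn_potential hk A f,
      coeFn_potential hk A (mulOp _ hG f), coeFn_mulOp hG f] with x a b c d
    rw [a, b, c, d, gaugeMap_commute, ← Complex.coe_smul, ← Complex.coe_smul, map_smul]
  have hneg : ∀ f, potential k hk (-A) f = - potential k hk A f := by
    intro f
    refine Lp.ext ?_
    filter_upwards [coeFn_potential hk A f, coeFn_potential hk (-A) f,
      Lp.coeFn_neg (potential k hk A f)] with x a b c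
    rw [b, c, Pi.neg_apply, a, map_neg, neg_apply, smul_neg]
  rw [mem_graph_approxDirac, mem_gaugeRel]
  constructor
  · rintro ⟨g, hg, h2⟩
    refine ⟨_, _, HasWeakDerivOn.mulOp_gaugeMap hs hB hk hN hg, (hcancel _).symm, ?_⟩
    rw [hcancel, hcancel, h2, hneg, neg_add_eq_sub]
    rfl
  · rintro ⟨φ, w, hφ, h1, h2⟩
    have := HasWeakDerivOn.mulOp_gaugeMap hs hB hk hG hφ
    refine ⟨_, h1 ▸ this, ?_⟩
    rw [h2, map_add, hcomm, h1, add_sub_cancel_left]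
    rfl

end Graph

/-! ### The point interaction as a sharp gauge. -/

section Point

/-- The Heaviside function, vanishing at the origin. -/
def heaviside (x : ℝ) : ℝ := if 0 < x then 1 else 0

theorem abs_heaviside_le (x : ℝ) : |heaviside x| ≤ 1 := by
  unfold heaviside
  split_ifs <;> simp

theorem measurable_heaviside : Measurable heaviside :=
  Measurable.ite measurableSet_Ioi measurable_const measurable_const

theorem gaugeMap_heaviside (T : Spinor →L[ℂ] Spinor) (x : ℝ) (v : Spinor) :
    gaugeMap T (heaviside x) v = if 0 < x then NormedSpace.exp T v else
      (1 : Spinor →L[ℂ] Spinor) v := by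
  unfold heaviside
  split_ifs
  · rw [gaugeMap_one]
  · rw [gaugeMap_zero]

theorem HasWeakDerivOn.mulOp_heaviside {T : Spinor →L[ℂ] Spinor}
    (hG : MemLp (fun x => gaugeMap T (heaviside x)) ∞ volume) {u w : L2}
    (h : HasWeakDerivOn {0}ᶜ u w) : HasWeakDerivOn {0}ᶜ (mulOp _ hG u) (mulOp _ hG w) := by
  refine (h.ite_pos (locallyIntegrable_coe u) (locallyIntegrable_coe w)
    (NormedSpace.exp T) 1).congr ?_ ?_
  · filter_upwards [coeFn_mulOp hG u] with x a
    rw [a, gaugeMap_heaviside]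
  · filter_upwards [coeFn_mulOp hG w] with x a
    rw [a, gaugeMap_heaviside]

theorem spinorMap_exp (A : Matrix (Fin 2) (Fin 2) ℂ) :
    spinorMap (NormedSpace.exp A) = NormedSpace.exp (spinorMap A) := by
  let : NormedRing (Matrix (Fin 2) (Fin 2) ℂ) := Matrix.linftyOpNormedRing
  let : NormedAlgebra ℂ (Matrix (Fin 2) (Fin 2) ℂ) := Matrix.linftyOpNormedAlgebra
  let : NormedAlgebra ℚ (Matrix (Fin 2) (Fin 2) ℂ) := NormedAlgebra.restrictScalars ℚ ℂ _
  let : NormedAlgebra ℚ (Spinor →L[ℂ] Spinor) := NormedAlgebra.restrictScalars ℚ ℂ _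
  exact NormedSpace.map_exp (Matrix.toEuclideanCLM (𝕜 := ℂ) (n := Fin 2))
    (LinearMap.continuous_of_finiteDimensional
      (Matrix.toEuclideanCLM (𝕜 := ℂ) (n := Fin 2)).toAlgEquiv.toLinearMap) A

/-- The inverse gauge cancels the jump `Λ = exp A`, so the transformed function has equal one-sided
limits and its singularity at the origin is removable. Conversely, the sharp gauge creates exactly
this jump. -/
theorem mem_graph_pointDirac_iff (M : ℝ) (A : Matrix (Fin 2) (Fin 2) ℂ)
    (hG : MemLp (fun x => gaugeMap (spinorMap A) (heaviside x)) ∞ volume)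
    (p : L2 × L2) : p ∈ (pointDirac M (NormedSpace.exp A)).graph ↔
      p ∈ gaugeRel derivRel (matOp sigma1) ((M : ℂ) • matOp sigma3) (mulOp _ hG) := by
  have hN : MemLp (fun x => gaugeMap (-spinorMap A) (heaviside x)) ∞ volume :=
    memLp_gaugeMap _ measurable_heaviside.aestronglyMeasurable abs_heaviside_le
  rw [mem_graph_pointDirac, mem_gaugeRel]
  constructor
  · rintro ⟨⟨m, f, hfp, -, hl, hr⟩, g, hg, h2⟩
    have hφ := hg.mulOp_heaviside hN
    refine ⟨_, mulOp _ hN g, ?_, (mulOp_neg_apply hG hN _).symm, ?_⟩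
    · refine hφ.univ_of_tendsto (c := fun x => gaugeMap (-spinorMap A) (heaviside x) (f x))
        (locallyIntegrable_coe _) (locallyIntegrable_coe _) ?_ (m := m) ?_
      · filter_upwards [coeFn_mulOp hN p.1, hfp] with x a b
        rw [a, b]
      · rw [punctured_nhds_eq_nhdsWithin_sup_nhdsWithin, tendsto_sup]
        constructor
        · refine hl.congr' ?_
          filter_upwards [self_mem_nhdsWithin] with x hx
          rw [gaugeMap_heaviside, if_neg (not_lt.2 (le_of_lt hx))]
          rfl
        · have h3 := ((NormedSpace.exp (-spinorMap A)).continuous.tendsto _).comp hr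
          rw [spinorMap_exp, ← gaugeMap_one, ← gaugeMap_one, gaugeMap_neg_apply] at h3
          refine h3.congr' ?_
          filter_upwards [self_mem_nhdsWithin] with x hx
          rw [gaugeMap_heaviside, if_pos (Set.mem_Ioi.1 hx), gaugeMap_one]
          rfl
    · rw [mulOp_neg_apply hG hN, mulOp_neg_apply hG hN, h2]
      rfl
  · rintro ⟨φ, w, hφ, h1, h2⟩
    have hφ' : HasWeakDerivOn Set.univ φ w := hφ
    obtain ⟨f, hfφ, hf⟩ := hφ'.exists_isPrimitive (locallyIntegrable_coe φ)
      (locallyIntegrable_coe w)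
    refine ⟨⟨f 0, fun x => gaugeMap (spinorMap A) (heaviside x) (f x), ?_, ?_, ?_, ?_⟩,
      mulOp _ hG w, ?_, ?_⟩
    · rw [h1]
      filter_upwards [coeFn_mulOp hG φ, hfφ] with x a b
      rw [a, b]
    · intro x hx
      refine ContinuousAt.continuousWithinAt ?_
      rcases lt_or_gt_of_ne (Set.mem_compl_singleton_iff.1 hx) with hx | hx
      · refine hf.continuous.continuousAt.congr ?_
        filter_upwards [Iio_mem_nhds hx] with y hy
        rw [gaugeMap_heaviside, if_neg (not_lt.2 (le_of_lt hy))]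
        rfl
      · refine ((NormedSpace.exp (spinorMap A)).continuous.comp
          hf.continuous).continuousAt.congr ?_
        filter_upwards [Ioi_mem_nhds hx] with y hy
        rw [gaugeMap_heaviside, if_pos (Set.mem_Ioi.1 hy)]
        rfl
    · refine ((hf.continuous.tendsto 0).mono_left nhdsWithin_le_nhds).congr' ?_
      filter_upwards [self_mem_nhdsWithin] with x hx
      rw [gaugeMap_heaviside, if_neg (not_lt.2 (le_of_lt hx))]
      rfl
    · rw [spinorMap_exp]
      refine ((((NormedSpace.exp (spinorMap A)).continuous.comp hf.continuous).tendsto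
        0).mono_left nhdsWithin_le_nhds).congr' ?_
      filter_upwards [self_mem_nhdsWithin] with x hx
      rw [gaugeMap_heaviside, if_pos (Set.mem_Ioi.1 hx)]
      rfl
    · rw [h1]
      exact (hφ'.mono (Set.subset_univ _)).mulOp_heaviside hG
    · rw [h2, h1]
      rfl

end Point

/-! ### The distribution function of `h`. -/

section Cumulative

/-- The distribution function of `h`. -/
def cumulative (h : ℝ → ℝ) (x : ℝ) : ℝ := ∫ t in Set.Iic x, h t

variable {h : ℝ → ℝ}

theorem isPrimitive_cumulative (hh : Integrable h) : IsPrimitive (cumulative h) h :=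
  ⟨hh.locallyIntegrable, fun _ _ =>
    intervalIntegral.integral_Iic_sub_Iic hh.integrableOn hh.integrableOn⟩

theorem abs_cumulative_le (hh : Integrable h) (x : ℝ) : |cumulative h x| ≤ ∫ t, ‖h t‖ :=
  (norm_integral_le_integral_norm _).trans
    (setIntegral_le_integral hh.norm (Eventually.of_forall fun _ => norm_nonneg _))

theorem isPrimitive_cumulative_div (hh : Integrable h) {ε : ℝ} (hε : 0 < ε) :
    IsPrimitive (fun x => cumulative h (x / ε)) (scaled h ε) := by
  have hi : Integrable (scaled h ε) := (hh.comp_div hε.ne').const_mul _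
  refine ⟨hi.locallyIntegrable, fun a b => ?_⟩
  rw [(isPrimitive_cumulative hh).sub_eq]
  unfold scaled
  rw [intervalIntegral.integral_const_mul, intervalIntegral.integral_comp_div _ hε.ne',
    smul_eq_mul, ← mul_assoc, one_div, inv_mul_cancel₀ hε.ne', one_mul]

theorem tendsto_cumulative_atTop (hh : Integrable h) :
    Tendsto (cumulative h) atTop (𝓝 (∫ x, h x)) := by
  rw [← intervalIntegral.integral_Iic_add_Ioi (b := 0) hh.integrableOn hh.integrableOn]
  refine ((intervalIntegral_tendsto_integral_Ioi 0 hh.integrableOn tendsto_id).const_add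
    _).congr fun x => ?_
  rw [id, ← (isPrimitive_cumulative hh).sub_eq]
  exact add_sub_cancel _ _

theorem tendsto_cumulative_atBot (hh : Integrable h) :
    Tendsto (cumulative h) atBot (𝓝 0) := by
  have := (intervalIntegral_tendsto_integral_Iic 0 hh.integrableOn tendsto_id).const_sub
    (∫ x in Set.Iic 0, h x)
  rw [sub_self] at this
  refine this.congr fun x => ?_
  rw [id, ← (isPrimitive_cumulative hh).sub_eq]
  exact sub_sub_cancel _ _

theorem exists_abs_cumulative_sub_heaviside_le (hh : Integrable h) (h1 : ∫ x, h x = 1) {η : ℝ}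
    (hη : 0 < η) : ∃ X, 0 < X ∧ ∀ x, X < |x| → |cumulative h x - heaviside x| ≤ η := by
  have ht := tendsto_cumulative_atTop hh
  rw [h1] at ht
  obtain ⟨a, ha⟩ := eventually_atTop.1 (ht.eventually (Metric.closedBall_mem_nhds _ hη))
  obtain ⟨b, hb⟩ := eventually_atBot.1
    ((tendsto_cumulative_atBot hh).eventually (Metric.closedBall_mem_nhds _ hη))
  -- The 1 in the maximum only ensures that `X` is positive.
  refine ⟨max 1 (max a (-b)), lt_of_lt_of_le one_pos (le_max_left _ _), fun x hx => ?_⟩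
  have hx1 : a < |x| := ((le_max_left a (-b)).trans (le_max_right _ _)).trans_lt hx
  have hx2 : -b < |x| := ((le_max_right a (-b)).trans (le_max_right _ _)).trans_lt hx
  unfold heaviside
  split_ifs with h0
  · rw [abs_of_pos h0] at hx1
    exact ha x hx1.le
  · rw [abs_of_nonpos (not_lt.1 h0)] at hx2
    exact hb x (neg_lt_neg_iff.1 hx2).le

end Cumulative

/-! ### Convergence of the smoothed gauge to the sharp one. -/

theorem heaviside_div {ε : ℝ} (hε : 0 < ε) (x : ℝ) : heaviside (x / ε) = heaviside x := by
  unfold heaviside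
  simp only [div_pos_iff_of_pos_right hε]

/-- An element of `L²` which is pointwise dominated by a multiple of `φ`, except on a set where
it is bounded. -/
theorem norm_le_of_ae_le {F φ : L2} {a c : ℝ} (ha : 0 ≤ a) (hc : 0 ≤ c) {s : Set ℝ}
    (hs : MeasurableSet s) (hμ : volume s ≠ ⊤)
    (h : ∀ᵐ x, ‖F x‖ ≤ a * ‖φ x‖ + s.indicator (fun _ => c) x) :
    ‖F‖ ≤ a * ‖φ‖ + c * volume.real s ^ (1 / 2 : ℝ) := by
  let Φ : Lp ℝ 2 (volume : Measure ℝ) := (Lp.memLp φ).norm.toLp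
  let I : Lp ℝ 2 (volume : Measure ℝ) := indicatorConstLp 2 hs hμ c
  have hΦ : ‖Φ‖ = ‖φ‖ := by
    rw [Lp.norm_toLp, eLpNorm_norm, Lp.norm_def]
  have hI : ‖I‖ = c * volume.real s ^ (1 / 2 : ℝ) := by
    rw [norm_indicatorConstLp (by norm_num) (by norm_num), Real.norm_of_nonneg hc]
    norm_num
  have hF : ‖F‖ ≤ ‖a • Φ + I‖ := by
    refine Lp.norm_le_norm_of_ae_le ?_
    filter_upwards [h, Lp.coeFn_add (a • Φ) I, Lp.coeFn_smul a Φ, (Lp.memLp φ).norm.coeFn_toLp,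
      indicatorConstLp_coeFn (p := 2) (hs := hs) (hμs := hμ) (c := c)] with x h1 h2 h3 h4 h5
    have e : (a • Φ + I : Lp ℝ 2 volume) x = a * ‖φ x‖ + s.indicator (fun _ => c) x := by
      rw [h2, Pi.add_apply, h3, Pi.smul_apply, h4, h5, smul_eq_mul]
    rw [e]
    exact h1.trans (le_abs_self _)
  refine hF.trans ((norm_add_le _ _).trans ?_)
  rw [norm_smul, Real.norm_of_nonneg ha, hΦ, hI]

/-- The smoothed gauge converges to the sharp one, as maps from `W^{1,2}` to `L²`. -/
theorem eventually_norm_mulOp_sub_le {h : ℝ → ℝ} (hh : Integrable h) (h1 : ∫ x, h x = 1)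
    (T : Spinor →L[ℂ] Spinor)
    (hG : ∀ ε, MemLp (fun x => gaugeMap T (cumulative h (x / ε))) ∞ volume)
    (hG₀ : MemLp (fun x => gaugeMap T (heaviside x)) ∞ volume) {η : ℝ} (hη : 0 < η) :
    ∀ᶠ ε in 𝓝[>] (0 : ℝ), ∀ φ w : L2, (φ, w) ∈ derivRel →
      ‖mulOp _ (hG ε) φ - mulOp _ hG₀ φ‖ ≤ η * (‖φ‖ + ‖w‖) := by
  set B := max 1 (∫ t, ‖h t‖)
  have hB : ∀ x, |cumulative h x| ≤ B := fun x => (abs_cumulative_le hh x).trans (le_max_right _ _)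
  have hB₀ : ∀ x, |heaviside x| ≤ B := fun x => (abs_heaviside_le x).trans (le_max_left _ _)
  obtain ⟨C, hC0, hC, hL⟩ := exists_gaugeMap_bound T B
  -- The Lipschitz constant `C` of the exponential turns this tolerance into at most `η / 2`; the
  -- added 1 covers `C = 0`.
  obtain ⟨X, hX, hXb⟩ := exists_abs_cumulative_sub_heaviside_le hh h1
    (η := η / (2 * (C + 1))) (by positivity)
  -- This is the `L²` norm of the constant `2 C` on `[-εX, εX]`, the contribution of the transition
  -- layer per unit of `‖φ‖ + ‖w‖`.
  have hlim : Tendsto (fun ε : ℝ => 2 * C * (2 * (ε * X)) ^ (1 / 2 : ℝ)) (𝓝[>] 0) (𝓝 0) := by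
    have hcont : Continuous fun ε : ℝ => 2 * C * (2 * (ε * X)) ^ (1 / 2 : ℝ) :=
      continuous_const.mul (Continuous.rpow_const (by fun_prop) fun _ => Or.inr (by norm_num))
    have := (hcont.tendsto 0).mono_left (nhdsWithin_le_nhds (s := Set.Ioi 0))
    simpa using this
  filter_upwards [hlim.eventually (gt_mem_nhds (half_pos hη)), self_mem_nhdsWithin]
    with ε hε hε0 φ w hφ
  have hε0 : 0 < ε := hε0
  have hP := HasWeakDerivOn.ae_norm_le hφ
  simp only at hP
  have hsub : ∀ᵐ x, ‖(mulOp _ (hG ε) φ - mulOp _ hG₀ φ : L2) x‖ ≤ η / 2 * ‖φ x‖ +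
      (Set.Icc (-(ε * X)) (ε * X)).indicator (fun _ => 2 * C * (‖φ‖ + ‖w‖)) x := by
    filter_upwards [hP, coeFn_mulOp (hG ε) φ, coeFn_mulOp hG₀ φ,
      Lp.coeFn_sub (mulOp _ (hG ε) φ) (mulOp _ hG₀ φ)] with x a b c d
    rw [d, Pi.sub_apply, b, c, ← sub_apply]
    refine ((gaugeMap T (cumulative h (x / ε)) - gaugeMap T (heaviside x)).le_opNorm _).trans ?_
    by_cases hx : x ∈ Set.Icc (-(ε * X)) (ε * X)
    · rw [Set.indicator_of_mem hx]
      have h2 : ‖gaugeMap T (cumulative h (x / ε)) - gaugeMap T (heaviside x)‖ ≤ 2 * C := by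
        refine (norm_sub_le _ _).trans ?_
        linarith [hC _ (hB (x / ε)), hC _ (hB₀ x)]
      have h3 : 0 ≤ η / 2 * ‖φ x‖ := by positivity
      refine le_trans ?_ (le_add_of_nonneg_left h3)
      gcongr
    · rw [Set.indicator_of_notMem hx, add_zero]
      gcongr
      have hx' : X < |x / ε| := by
        rw [Set.mem_Icc, ← abs_le, not_le] at hx
        rw [abs_div, abs_of_pos hε0, lt_div_iff₀ hε0, mul_comm]
        exact hx
      have h2 := hXb _ hx'
      rw [heaviside_div hε0] at h2
      refine (hL _ _ (hB _) (hB₀ _)).trans ?_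
      calc C * |cumulative h (x / ε) - heaviside x| ≤ (C + 1) * (η / (2 * (C + 1))) := by
            gcongr
            linarith
        _ = η / 2 := by field_simp
  refine (norm_le_of_ae_le (half_pos hη).le (by positivity) measurableSet_Icc (by simp)
    hsub).trans ?_
  have hvol : volume.real (Set.Icc (-(ε * X)) (ε * X)) = 2 * (ε * X) := by
    rw [Measure.real, Real.volume_Icc, ENNReal.toReal_ofReal (by nlinarith)]
    ring
  rw [hvol]
  have hw := norm_nonneg w
  have hn := norm_nonneg φ
  nlinarith [mul_le_mul_of_nonneg_right hε.le (add_nonneg hn hw)]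

theorem norm_star_spinor (S : Spinor →L[ℂ] Spinor) : ‖star S‖ = ‖S‖ := by
  rw [ContinuousLinearMap.star_eq_adjoint, LinearIsometryEquiv.norm_map]

theorem continuous_star_spinor : Continuous (star : (Spinor →L[ℂ] Spinor) → _) :=
  (ContinuousLinearMap.adjoint (𝕜 := ℂ) (E := Spinor) (F := Spinor)).continuous

/-- This says that `i σ₁ A` is Hermitian; it is what makes the gauge preserve the form of `σ₁`. -/
theorem Admissible.star_mul_sigma1 {A : Matrix (Fin 2) (Fin 2) ℂ} (hA : Admissible A) :
    star A * sigma1 = -(sigma1 * A) := by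
  rcases hA with ⟨φ, -, -, rfl⟩ | ⟨⟨a, b, c, rfl⟩, -⟩
  · ext i j
    fin_cases i <;> fin_cases j <;> simp [sigma1, Matrix.mul_apply]
  · ext i j
    fin_cases i <;> fin_cases j <;> simp [sigma1, Matrix.mul_apply, Matrix.star_apply]

end DiracPoint

end

/-! ### Norm resolvent convergence. -/

theorem theorem1 (M : ℝ) (hM : 0 ≤ M)
    (h : ℝ → ℝ) (h_one : MemLp h 1 volume) (h_top : MemLp h ∞ volume) (h_int : ∫ x, h x = 1)
    (A : Matrix (Fin 2) (Fin 2) ℂ) (hA : DiracPoint.Admissible A) :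
    ∃ (R : ℝ → DiracPoint.L2 →L[ℂ] DiracPoint.L2) (R₀ : DiracPoint.L2 →L[ℂ] DiracPoint.L2),
      (∀ ε : ℝ, 0 < ε →
        DiracPoint.IsResolventAt (DiracPoint.approxDirac M h h_top A ε) (-Complex.I) (R ε)) ∧
      DiracPoint.IsResolventAt (DiracPoint.pointDirac M (NormedSpace.exp A)) (-Complex.I) R₀ ∧
      Tendsto (fun ε : ℝ => ‖R ε - R₀‖) (𝓝[>] 0) (𝓝 0) := by
  open DiracPoint in
  have hh : Integrable h := memLp_one_iff_integrable.1 h_one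
  -- One bound for both phases: 1 for the Heaviside function, `∫ ‖h‖` for the distribution function.
  set B := max 1 (∫ t, ‖h t‖)
  have hB : ∀ x, |cumulative h x| ≤ B := fun x => (abs_cumulative_le hh x).trans (le_max_right _ _)
  have hB₀ : ∀ x, |heaviside x| ≤ B := fun x => (abs_heaviside_le x).trans (le_max_left _ _)
  obtain ⟨C, hC0, hC, -⟩ := exists_gaugeMap_bound (spinorMap A) B
  have hcont : Continuous (cumulative h) := (isPrimitive_cumulative hh).continuous
  have hm : ∀ ε : ℝ, AEStronglyMeasurable (fun x => cumulative h (x / ε)) volume := fun ε =>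
    (hcont.comp (continuous_id.div_const ε)).aestronglyMeasurable
  have hstar : ∀ {s : ℝ → ℝ}, AEStronglyMeasurable s volume → (∀ x, |s x| ≤ B) →
      MemLp (fun x => star (gaugeMap (spinorMap A) (s x))) ∞ volume := fun hs hsB =>
    memLp_top_of_bound (continuous_star_spinor.comp_aestronglyMeasurable
      ((continuous_gaugeMap _).comp_aestronglyMeasurable hs)) C
      (Eventually.of_forall fun x => by rw [norm_star_spinor]; exact hC _ (hsB x))
  have hG : ∀ ε, MemLp (fun x => gaugeMap (spinorMap A) (cumulative h (x / ε))) ∞ volume :=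
    fun ε => memLp_gaugeMap _ (hm ε) fun x => hB _
  have hG₀ : MemLp (fun x => gaugeMap (spinorMap A) (heaviside x)) ∞ volume :=
    memLp_gaugeMap _ measurable_heaviside.aestronglyMeasurable hB₀
  have hG' := fun ε => hstar (hm ε) fun x => hB _
  have hG₀' := hstar measurable_heaviside.aestronglyMeasurable hB₀
  have hΓ := fun ε => isGauge_gaugeMap hA.star_mul_sigma1 (hG ε) (hG' ε)
  have hΓ₀ := isGauge_gaugeMap hA.star_mul_sigma1 hG₀ hG₀'
  have hD := isDiracSystem M
  choose R hR using fun ε =>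
    (isSelfAdjointRel_gaugeRel hD (hΓ ε)).exists_resolvent (z := -Complex.I) (by simp) (by simp)
  obtain ⟨R₀, hR₀⟩ :=
    (isSelfAdjointRel_gaugeRel hD hΓ₀).exists_resolvent (z := -Complex.I) (by simp) (by simp)
  refine ⟨R, R₀, fun ε hε => (hR ε).isResolventAt
    (mem_graph_approxDirac_iff M h_top A (isPrimitive_cumulative_div hh hε) (fun x => hB _) (hG ε)),
    hR₀.isResolventAt (mem_graph_pointDirac_iff M A hG₀), ?_⟩
  set K := 4 * C * (C * (1 + ‖(M : ℂ) • matOp sigma3‖)) ^ 2 with hK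
  have hK0 : 0 ≤ K := by positivity
  rw [Metric.tendsto_nhds]
  intro η hη
  -- The resolvent difference is at most `K` times this tolerance, hence less than `η`; `K` does not
  -- depend on `ε`.
  filter_upwards [eventually_norm_mulOp_sub_le hh h_int (spinorMap A) hG hG₀
    (η := η / (K + 1)) (by positivity)] with ε hε
  have hle := norm_resolvent_sub_le hD (hΓ ε) hΓ₀ hC0 (by positivity)
    (norm_mulOp_le _ (Eventually.of_forall fun x => hC _ (hB _)))
    (norm_mulOp_le _ (Eventually.of_forall fun x => by rw [norm_star_spinor]; exact hC _ (hB _)))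
    (norm_mulOp_le _ (Eventually.of_forall fun x => hC _ (hB₀ _)))
    (norm_mulOp_le _ (Eventually.of_forall fun x => by rw [norm_star_spinor]; exact hC _ (hB₀ _)))
    hε (hR ε) hR₀
  rw [dist_zero_right, norm_norm]
  refine hle.trans_lt ?_
  rw [← hK, ← mul_div_assoc, div_lt_iff₀ (by positivity)]
  nlinarith
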